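/- Let $n\ge 1$ and consider the $n\times n$ input-queued switch in discrete time, with queue lengths $q(t)=(q_{ij}(t))_{1\le i,j\le n}\in\mathbb{Z}_{\ge 0}^{n\times n}$. In each time slot $t$ a schedule $s(t)$, a permutation matrix (perfect matching of inputs and outputs), is chosen on the basis of $q(t)$, arrivals $a(t)=(a_{ij}(t))$ occur, independent of the past and of $s(t)$, and $$q_{ij}(t+1)=\max\{q_{ij}(t)+a_{ij}(t)-s_{ij}(t),0\}.$$ The scheduling algorithm is MaxWeight: $s(t)$ is always a permutation matrix maximizing $\langle q(t),s\rangle=\sum_{ij}q_{ij}(t)s_{ij}$, ties being broken by an arbitrary fixed, possibly randomized, rule that depends only on $q(t)$ (for instance uniformly at random). For $0<\varepsilon<1$ the traffic is uniform Bernoulli, completely saturating as $\varepsilon\downarrow0$: the $a_{ij}(t)$ are independent over $i,j,t$, take values in $\{0,1\}$, and have mean $\lambda^{(\varepsilon)}_{ij}=(1-\varepsilon)/n$ for all $i,j$. Then for every $\varepsilon\in(0,1)$ the Markov chain $q^{(\varepsilon)}(t)$ has a unique steady-state law: a stationary law to which, from every initial state, $q^{(\varepsilon)}(t)$ converges in distribution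 as $t\to\infty$. A random matrix $\overline q^{(\varepsilon)}$ with this law satisfies $\mathbb{E}\big[\sum_{ij}\overline q^{(\varepsilon)}_{ij}\big]<\infty$, and $$\lim_{\varepsilon\downarrow 0}\ \varepsilon\,\mathbb{E}\Big[\sum_{ij}\overline q^{(\varepsilon)}_{ij}\Big]=\frac{2n-1}{2}\Big(1-\frac1n\Big).$$ -/

import Mathlib

open Filter Topology MeasureTheory

noncomputable section

namespace Switch

/-- Queue lengths of an `n × n` input-queued switch: `q i j` is the number of packets waiting at
input port `i` for output port `j`. -/
abbrev QueueState (n : ℕ) : Type := Fin n → Fin n → ℕ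

/-- The packets arriving in one time slot under Bernoulli traffic: `a i j = true` when one packet
for output `j` arrives at input `i`, and `a i j = false` when none does. -/
abbrev Arrivals (n : ℕ) : Type := Fin n → Fin n → Bool

/-- A (maximal) schedule is a perfect matching between inputs and outputs, that is, a permutation:
input `i` is connected to output `s i`. -/
abbrev Schedule (n : ℕ) : Type := Equiv.Perm (Fin n)

theorem arrival_weights_sum {n : ℕ} (rate : Fin n → Fin n → unitInterval) :
    ∑ a : Arrivals n, ∏ i, ∏ j,
      ENNReal.ofReal (if a i j then (rate i j : ℝ) else 1 - (rate i j : ℝ)) = 1 := by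
  have row : ∀ i : Fin n, ∑ b : Fin n → Bool, ∏ j,
      ENNReal.ofReal (if b j then (rate i j : ℝ) else 1 - (rate i j : ℝ)) = 1 := by
    intro i
    have h := Fintype.prod_sum (fun (j : Fin n) (c : Bool) =>
      ENNReal.ofReal (if c then (rate i j : ℝ) else 1 - (rate i j : ℝ)))
    rw [← h]
    refine Finset.prod_eq_one fun j _ => ?_
    rw [Fintype.sum_bool]
    have h0 := (rate i j).2.1
    have h1 := (rate i j).2.2
    rw [← ENNReal.ofReal_add (by simpa using h0) (by simpa using h1)]
    simp
  have h := Fintype.prod_sum (fun (i : Fin n) (b : Fin n → Bool) =>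
    ∏ j, ENNReal.ofReal (if b j then (rate i j : ℝ) else 1 - (rate i j : ℝ)))
  rw [← h]
  exact Finset.prod_eq_one fun i _ => row i

/-- The law of the arrivals in one time slot: independent Bernoulli variables, the one for the
pair `(i, j)` having mean `rate i j`. -/
def arrivalLaw {n : ℕ} (rate : Fin n → Fin n → unitInterval) : PMF (Arrivals n) :=
  PMF.ofFintype
    (fun a => ∏ i, ∏ j,
      ENNReal.ofReal (if a i j then (rate i j : ℝ) else 1 - (rate i j : ℝ)))
    (arrival_weights_sum rate)

/-- The weight `⟨q, s⟩` of the schedule `s` when the queue lengths are `q`. -/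
def weight {n : ℕ} (q : QueueState n) (s : Schedule n) : ℕ := ∑ i, q i (s i)

/-- A scheduling policy chooses a schedule, possibly at random, from the current queue lengths.
It is a MaxWeight policy when it always chooses a schedule of maximum weight; the way in which
ties are broken is arbitrary. -/
def IsMaxWeight {n : ℕ} (policy : QueueState n → PMF (Schedule n)) : Prop :=
  ∀ q, ∀ s ∈ (policy q).support, ∀ s' : Schedule n, weight q s' ≤ weight q s

/-- The queue lengths in the next slot, `[q + a - s]⁺`. The subtraction is the truncated one of
the natural numbers, which is the positive part. -/
def nextQueue {n : ℕ} (q : QueueState n) (a : Arrivals n) (s : Schedule n) : QueueState n :=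
  fun i j => (q i j + (if a i j then 1 else 0)) - (if s i = j then 1 else 0)

/-- The one-step transition law of the queue length Markov chain: the schedule is chosen from the
current queue lengths, and the arrivals are drawn independently of the past and of the schedule. -/
def step {n : ℕ} (rate : Fin n → Fin n → unitInterval)
    (policy : QueueState n → PMF (Schedule n)) (q : QueueState n) : PMF (QueueState n) :=
  (policy q).bind fun s => (arrivalLaw rate).map fun a => nextQueue q a s

/-- The law at time `t` of the Markov chain with transition law `K` started at `x`. -/
def lawAt {α : Type*} (K : α → PMF α) (x : α) : ℕ → PMF α
  | 0 => PMF.pure x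
  | t + 1 => (lawAt K x t).bind K

/-- The probability measure on the space of queue lengths given by a mass function. -/
def toProb {n : ℕ} (p : PMF (QueueState n)) : ProbabilityMeasure (QueueState n) :=
  ⟨p.toMeasure, inferInstance⟩

/-- `p` is the steady-state law of the chain with transition law `K`: it is stationary, and from
every initial state the chain converges in distribution (weakly) to `p`. -/
structure IsSteadyState {n : ℕ} (K : QueueState n → PMF (QueueState n))
    (p : PMF (QueueState n)) : Prop where
  stationary : p.bind K = p
  tendsto : ∀ q : QueueState n,
    Tendsto (fun t => toProb (lawAt K q t)) atTop (𝓝 (toProb p))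

/-- The total queue length `∑ᵢⱼ qᵢⱼ`. -/
def totalQueue {n : ℕ} (q : QueueState n) : ℝ := ∑ i, ∑ j, (q i j : ℝ)

/-- The uniform arrival rates `λᵢⱼ = (1 - ε) / n`, for `0 < ε < 1`. -/
def uniformRate (n : ℕ) (ε : Set.Ioo (0 : ℝ) 1) : Fin n → Fin n → unitInterval :=
  fun i _ => ⟨(1 - (ε : ℝ)) / n, by
    have h0 := ε.2.1
    have h1 := ε.2.2
    have hn : (1 : ℝ) ≤ n := by exact_mod_cast i.pos
    constructor
    · apply div_nonneg <;> linarith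
    · rw [div_le_one (by linarith)]
      linarith⟩

end Switch

end

/-!
Write `U` for the space of matrices with vanishing row and column sums. MaxWeight gives `‖q‖²` a
negative drift proportional to `‖q‖`, and the projection of `q` onto `U` has a negative drift
proportional to its norm whose rate does not degenerate as `ε ↓ 0`. The fourth powers of these norms
are then Lyapunov functions: the first yields a steady state, the second bounds the stationary
second moment of the projection uniformly in `ε`, which is the collapse of the state space onto
`Uᗮ`. The chain forgets its initial state because the gap between two independent copies is
subharmonic for the product chain and vanishes at the empty state.

Let `P` be the projection onto `Uᗮ`, let `a` be the arrivals, `s` the schedule and `u` the unused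
services, so that the next state is `q' = q + a - s + u` with `⟪q', u⟫ = 0`. The stationary mean of
`‖P q‖²` does not change in one step. Here `E⟪P q, a - s⟫ = -(ε / n) ∑ qᵢⱼ` and `E‖P (a - s)‖²` is
explicit, for every permutation matrix has the same row and column sums. Since `⟪q', u⟫ = 0`, the
terms with `u` only involve `‖P u‖²` and the inner product of `u` with the projection of `q'` onto
`U`; they vanish in the limit by the collapse and because `E‖u‖² = n ε`.
-/

open scoped ENNReal InnerProductSpace

noncomputable section

namespace Switch

section Expectation

variable {α β : Type*} [MeasurableSpace α] [DiscreteMeasurableSpace α]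
  [MeasurableSpace β]

theorem ae_toMeasure_iff {p : PMF α} {P : α → Prop} :
    (∀ᵐ x ∂p.toMeasure, P x) ↔ ∀ x ∈ p.support, P x := by
  rw [ae_iff, PMF.toMeasure_apply_eq_zero_iff _ .of_discrete, Set.disjoint_left]
  simp only [Set.mem_ofPred_eq, not_not]

theorem integrable_of_bounded_on_support {p : PMF α} {f : α → ℝ} {B : ℝ}
    (hf : ∀ x ∈ p.support, |f x| ≤ B) : Integrable f p.toMeasure :=
  Integrable.of_bound (Measurable.of_discrete.aestronglyMeasurable) B (ae_toMeasure_iff.2 hf)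

variable [Countable α]

theorem toMeasure_bind (p : PMF α) (k : α → PMF β) :
    (p.bind k).toMeasure = p.toMeasure.bind fun x => (k x).toMeasure := by
  ext s hs
  rw [PMF.toMeasure_bind_apply _ _ _ hs, Measure.bind_apply hs Measurable.of_discrete.aemeasurable,
    lintegral_countable']
  simp only [PMF.toMeasure_apply_singleton _ _ .of_discrete, mul_comm]

theorem lintegral_pmf_bind (p : PMF α) (k : α → PMF β) {f : β → ℝ≥0∞} (hf : Measurable f) :
    ∫⁻ y, f y ∂(p.bind k).toMeasure = ∫⁻ x, ∫⁻ y, f y ∂(k x).toMeasure ∂p.toMeasure := by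
  rw [toMeasure_bind, Measure.lintegral_bind Measurable.of_discrete.aemeasurable hf.aemeasurable]

theorem integrable_integral_pmf_bind {p : PMF α} {k : α → PMF β} {f : β → ℝ}
    (hf : Integrable f (p.bind k).toMeasure) :
    Integrable (fun x => ∫ y, f y ∂(k x).toMeasure) p.toMeasure := by
  let κ : ProbabilityTheory.Kernel α β := ⟨fun x => (k x).toMeasure, Measurable.of_discrete⟩
  rw [toMeasure_bind] at hf
  exact Integrable.integral_comp (κ := .const Unit p.toMeasure) (η := κ) (a := ()) (by
    rwa [ProbabilityTheory.Kernel.comp_apply])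

theorem integral_pmf_bind {p : PMF α} {k : α → PMF β} {f : β → ℝ}
    (hf : Integrable f (p.bind k).toMeasure) :
    ∫ y, f y ∂(p.bind k).toMeasure = ∫ x, ∫ y, f y ∂(k x).toMeasure ∂p.toMeasure := by
  let κ : ProbabilityTheory.Kernel α β := ⟨fun x => (k x).toMeasure, Measurable.of_discrete⟩
  rw [toMeasure_bind] at hf ⊢
  have h := ProbabilityTheory.Kernel.integral_comp (κ := .const Unit p.toMeasure) (η := κ)
    (a := ()) (f := f) (by rwa [ProbabilityTheory.Kernel.comp_apply])
  rwa [ProbabilityTheory.Kernel.comp_apply] at h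

end Expectation

section MaximumPrinciple

variable {β : Type*} [MeasurableSpace β] {Q : β → Measure β} {D V : β → ℝ≥0∞} {F : Set β}

/-- Below the barrier `D w + κ V` lie all but finitely many states, so if `D` exceeded it anywhere,
`D - κ V` would have a maximum outside `F`, which the drift of `V` rules out. -/
theorem le_add_mul_of_subharmonic_of_drift [∀ z, IsProbabilityMeasure (Q z)]
    [DiscreteMeasurableSpace β] {B : ℝ≥0∞} (hB : B ≠ ⊤) (hDB : ∀ z, D z ≤ B)
    (hD : ∀ z, D z ≤ ∫⁻ y, D y ∂Q z) (hVtop : ∀ z, V z ≠ ⊤)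
    (hVfin : ∀ M, M ≠ ⊤ → {z | V z ≤ M}.Finite) (hdrift : ∀ z ∉ F, ∫⁻ y, V y ∂Q z + 1 ≤ V z)
    {w : β} (hw : ∀ z ∈ F, D z ≤ D w) {κ : ℝ≥0∞} (hκ : κ ≠ 0) (hκtop : κ ≠ ⊤) (z : β) :
    D z ≤ D w + κ * V z := by
  by_contra! hz
  have hfin : {y | D w + κ * V y < D y}.Finite := by
    refine (hVfin (B / κ) (ENNReal.div_ne_top hB hκ)).subset fun y hy => ?_
    rw [Set.mem_ofPred_eq, ENNReal.le_div_iff_mul_le (.inl hκ) (.inl hκtop), mul_comm]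
    exact (le_add_self.trans hy.le).trans (hDB y)
  obtain ⟨y, hy : D w + κ * V y < D y, hmax⟩ :=
    hfin.exists_maximalFor (fun y => D y - κ * V y) _ ⟨z, hz⟩
  have hyF : y ∉ F := fun h => (hw y h).not_gt (le_self_add.trans_lt hy)
  have hκV : κ * V y ≤ D y := le_add_self.trans hy.le
  have hall : ∀ x, D x ≤ D y - κ * V y + κ * V x := by
    intro x
    by_cases hx : D w + κ * V x < D x
    · rw [← tsub_le_iff_right]
      exact (le_total (D x - κ * V x) (D y - κ * V y)).elim id (hmax hx)
    · refine (not_lt.1 hx).trans (add_le_add_left ?_ _)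
      exact ENNReal.le_sub_of_add_le_right (ENNReal.mul_ne_top hκtop (hVtop y)) hy.le
  have hlt : D y + κ ≤ D y := calc
    D y + κ ≤ ∫⁻ x, D y - κ * V y + κ * V x ∂Q y + κ := by
      gcongr
      exact (hD y).trans (lintegral_mono hall)
    _ = D y - κ * V y + κ * (∫⁻ x, V x ∂Q y + 1) := by
      rw [lintegral_add_left measurable_const, lintegral_const, measure_univ,
        lintegral_const_mul _ .of_discrete]
      ring
    _ ≤ D y - κ * V y + κ * V y := by gcongr; exact hdrift y hyF
    _ = D y := tsub_add_cancel_of_le hκV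
  exact hlt.not_gt (ENNReal.lt_add_right (ne_top_of_le_ne_top hB (hDB y)) hκ)

theorem le_of_subharmonic_of_drift [∀ z, IsProbabilityMeasure (Q z)] [DiscreteMeasurableSpace β]
    {B : ℝ≥0∞} (hB : B ≠ ⊤) (hDB : ∀ z, D z ≤ B) (hD : ∀ z, D z ≤ ∫⁻ y, D y ∂Q z)
    (hVtop : ∀ z, V z ≠ ⊤) (hVfin : ∀ M, M ≠ ⊤ → {z | V z ≤ M}.Finite)
    (hdrift : ∀ z ∉ F, ∫⁻ y, V y ∂Q z + 1 ≤ V z) {w : β} (hw : ∀ z ∈ F, D z ≤ D w) (z : β) :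
    D z ≤ D w := by
  have hlim : Tendsto (fun k : ℕ => D w + (k : ℝ≥0∞)⁻¹ * V z) atTop (𝓝 (D w + 0 * V z)) :=
    (ENNReal.Tendsto.mul_const ENNReal.tendsto_inv_nat_nhds_zero (.inr (hVtop z))).const_add _
  rw [zero_mul, add_zero] at hlim
  refine ge_of_tendsto hlim ((eventually_ne_atTop 0).mono fun k hk => ?_)
  exact le_add_mul_of_subharmonic_of_drift hB hDB hD hVtop hVfin hdrift hw
    (ENNReal.inv_ne_zero.2 (ENNReal.natCast_ne_top k))
    (ENNReal.inv_ne_top.2 (by exact_mod_cast hk)) z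

theorem eq_of_subharmonic_of_max {w z : β} [IsProbabilityMeasure (Q w)]
    (hDw : D w ≠ ⊤) (hD : D w ≤ ∫⁻ y, D y ∂Q w) (hmax : ∀ y, D y ≤ D w) (hz : Q w {z} ≠ 0) :
    D z = D w := by
  have hconst : ∫⁻ _, D w ∂Q w = D w := by simp
  have hle : ∫⁻ y, D y ∂Q w ≤ D w := hconst ▸ lintegral_mono hmax
  have hae : D =ᵐ[Q w] fun _ => D w :=
    ae_eq_of_ae_le_of_lintegral_le (.of_forall hmax) (ne_top_of_le_ne_top hDw hle)
      measurable_const.aemeasurable (hconst.trans_le hD)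
  by_contra hne
  exact hz (measure_mono_null (Set.singleton_subset_iff.2 hne) hae)

theorem eq_zero_of_subharmonic_of_drift [∀ z, IsProbabilityMeasure (Q z)]
    [DiscreteMeasurableSpace β] {B : ℝ≥0∞} (hB : B ≠ ⊤) (hDB : ∀ z, D z ≤ B)
    (hD : ∀ z, D z ≤ ∫⁻ y, D y ∂Q z) (hVtop : ∀ z, V z ≠ ⊤)
    (hVfin : ∀ M, M ≠ ⊤ → {z | V z ≤ M}.Finite) (hF : F.Finite)
    (hdrift : ∀ z ∉ F, ∫⁻ y, V y ∂Q z + 1 ≤ V z) {rank : β → ℕ}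
    (hrank : ∀ z, rank z ≠ 0 → ∃ z', Q z {z'} ≠ 0 ∧ rank z' < rank z)
    (hzero : ∀ z, rank z = 0 → D z = 0) (z : β) : D z = 0 := by
  obtain ⟨w, -, hw⟩ := (hF.insert z).exists_maximalFor D _ (Set.insert_nonempty z F)
  have hmax : ∀ y, D y ≤ D w := le_of_subharmonic_of_drift hB hDB hD hVtop hVfin hdrift
    fun y hy => (le_total (D y) (D w)).elim id (hw (Set.mem_insert_of_mem z hy))
  have hreach : ∀ k v, rank v = k → D v = D w → D w = 0 := by
    intro k
    induction k using Nat.strong_induction_on with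
    | _ k ih =>
      rintro v rfl hv
      by_cases hv0 : rank v = 0
      · rw [← hv, hzero v hv0]
      · obtain ⟨z', hz', hlt⟩ := hrank v hv0
        refine ih _ hlt z' rfl ((eq_of_subharmonic_of_max ?_ (hD v) ?_ hz').trans hv)
        · exact ne_top_of_le_ne_top hB (hDB v)
        · simpa only [hv] using hmax
  exact nonpos_iff_eq_zero.1 (hreach _ w rfl rfl ▸ hmax z)

end MaximumPrinciple

section MarkovChain

variable {α : Type*} {K : α → PMF α} {V f : α → ℝ≥0∞} {C : ℝ≥0∞}

theorem bind_lawAt {p : PMF α} (hp : p.bind K = p) (t : ℕ) :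
    (p.bind fun x => lawAt K x t) = p := by
  induction t with
  | zero => simp only [lawAt, PMF.bind_pure]
  | succ t ih => simp only [lawAt, ← PMF.bind_bind, ih, hp]

theorem lawAt_succ_eq_bind_lawAt (x : α) (t : ℕ) :
    lawAt K x (t + 1) = (K x).bind fun y => lawAt K y t := by
  induction t with
  | zero => simp only [lawAt, PMF.pure_bind, PMF.bind_pure]
  | succ t ih => rw [lawAt, ih, PMF.bind_bind]; rfl

variable [MeasurableSpace α]

/-- The Cesàro average of the laws of the chain at the times `0, …, T`: averaging over `T + 1`
times makes it a probability measure for every `T`. -/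
def cesaro (K : α → PMF α) (x : α) (T : ℕ) : Measure α :=
  ((T + 1 : ℕ) : ℝ≥0∞)⁻¹ • ∑ t ∈ Finset.range (T + 1), (lawAt K x t).toMeasure

theorem lintegral_cesaro (x : α) (T : ℕ) (g : α → ℝ≥0∞) :
    ∫⁻ y, g y ∂cesaro K x T = ((T + 1 : ℕ) : ℝ≥0∞)⁻¹ *
      ∑ t ∈ Finset.range (T + 1), ∫⁻ y, g y ∂(lawAt K x t).toMeasure := by
  rw [cesaro, lintegral_smul_measure, lintegral_finsetSum_measure, smul_eq_mul]

instance isProbabilityMeasure_cesaro (x : α) (T : ℕ) : IsProbabilityMeasure (cesaro K x T) where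
  measure_univ := by
    rw [← lintegral_one, lintegral_cesaro]
    simp only [lintegral_one, measure_univ, Finset.sum_const, Finset.card_range, nsmul_eq_mul,
      mul_one]
    exact ENNReal.inv_mul_cancel (by simp) (ENNReal.natCast_ne_top _)

variable [DiscreteMeasurableSpace α] [Countable α]

theorem lintegral_lawAt_add_sum_le
    (hdrift : ∀ x, ∫⁻ y, V y ∂(K x).toMeasure + f x ≤ V x + C) (x : α) (T : ℕ) :
    ∫⁻ y, V y ∂(lawAt K x T).toMeasure
      + ∑ t ∈ Finset.range T, ∫⁻ y, f y ∂(lawAt K x t).toMeasure ≤ V x + T * C := by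
  induction T with
  | zero => simp [lawAt, PMF.toMeasure_pure]
  | succ T ih =>
    have hstep : ∫⁻ y, V y ∂(lawAt K x (T + 1)).toMeasure + ∫⁻ y, f y ∂(lawAt K x T).toMeasure
        ≤ ∫⁻ y, V y ∂(lawAt K x T).toMeasure + C := calc
      _ = ∫⁻ y, ∫⁻ z, V z ∂(K y).toMeasure + f y ∂(lawAt K x T).toMeasure := by
        rw [lawAt, lintegral_pmf_bind _ _ .of_discrete, lintegral_add_left .of_discrete]
      _ ≤ ∫⁻ y, V y + C ∂(lawAt K x T).toMeasure := lintegral_mono hdrift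
      _ = _ := by rw [lintegral_add_left .of_discrete, lintegral_const, measure_univ, mul_one]
    calc _ = (∫⁻ y, V y ∂(lawAt K x (T + 1)).toMeasure + ∫⁻ y, f y ∂(lawAt K x T).toMeasure)
          + ∑ t ∈ Finset.range T, ∫⁻ y, f y ∂(lawAt K x t).toMeasure := by
          rw [Finset.sum_range_succ]; ring
      _ ≤ (∫⁻ y, V y ∂(lawAt K x T).toMeasure + C)
          + ∑ t ∈ Finset.range T, ∫⁻ y, f y ∂(lawAt K x t).toMeasure := by gcongr
      _ = (∫⁻ y, V y ∂(lawAt K x T).toMeasure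
          + ∑ t ∈ Finset.range T, ∫⁻ y, f y ∂(lawAt K x t).toMeasure) + C := by ring
      _ ≤ V x + T * C + C := by gcongr
      _ = V x + (T + 1 : ℕ) * C := by push_cast; ring

theorem lintegral_cesaro_le (hdrift : ∀ x, ∫⁻ y, V y ∂(K x).toMeasure + f x ≤ V x + C)
    (x : α) (T : ℕ) :
    ∫⁻ y, f y ∂cesaro K x T ≤ ((T + 1 : ℕ) : ℝ≥0∞)⁻¹ * V x + C := by
  rw [lintegral_cesaro]
  calc _ ≤ ((T + 1 : ℕ) : ℝ≥0∞)⁻¹ * (V x + (T + 1 : ℕ) * C) := by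
        gcongr
        exact le_add_self.trans (lintegral_lawAt_add_sum_le hdrift x (T + 1))
    _ = _ := by
      rw [mul_add, ← mul_assoc, ENNReal.inv_mul_cancel (by simp) (ENNReal.natCast_ne_top _),
        one_mul]

theorem lintegral_eq_lintegral_cesaro {p : PMF α} (hp : p.bind K = p) (g : α → ℝ≥0∞) (T : ℕ) :
    ∫⁻ x, g x ∂p.toMeasure = ∫⁻ x, ∫⁻ y, g y ∂cesaro K x T ∂p.toMeasure := by
  have hlaw : ∀ t, ∫⁻ x, ∫⁻ y, g y ∂(lawAt K x t).toMeasure ∂p.toMeasure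
      = ∫⁻ x, g x ∂p.toMeasure := fun t => by
    rw [← lintegral_pmf_bind _ _ .of_discrete, bind_lawAt hp]
  simp only [lintegral_cesaro]
  rw [lintegral_const_mul _ .of_discrete, lintegral_finsetSum _ fun _ _ => .of_discrete]
  simp only [hlaw, Finset.sum_const, Finset.card_range, nsmul_eq_mul]
  rw [← mul_assoc, ENNReal.inv_mul_cancel (by simp) (ENNReal.natCast_ne_top _), one_mul]

/-- Truncating `f` at `M` lets the bound `(T + 1)⁻¹ * V x + C` on its Cesàro averages be integrated
against `p` although `V` need not be integrable. -/
theorem lintegral_le_of_stationary (hVtop : ∀ x, V x ≠ ⊤)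
    (hdrift : ∀ x, ∫⁻ y, V y ∂(K x).toMeasure + f x ≤ V x + C) {p : PMF α} (hp : p.bind K = p) :
    ∫⁻ x, f x ∂p.toMeasure ≤ C := by
  have truncated : ∀ M : ℕ, ∫⁻ x, min (f x) M ∂p.toMeasure ≤ C := by
    intro M
    let b : ℕ → α → ℝ≥0∞ := fun T x => min M (((T + 1 : ℕ) : ℝ≥0∞)⁻¹ * V x + C)
    have hle : ∀ T, ∫⁻ x, min (f x) M ∂p.toMeasure ≤ ∫⁻ x, b T x ∂p.toMeasure := by
      intro T
      rw [lintegral_eq_lintegral_cesaro hp _ T]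
      refine lintegral_mono fun x => le_min ?_ ?_
      · calc ∫⁻ y, min (f y) M ∂cesaro K x T ≤ ∫⁻ _, M ∂cesaro K x T :=
            lintegral_mono fun y => min_le_right _ _
          _ = M := by simp
      · exact (lintegral_mono fun y => min_le_left _ _).trans (lintegral_cesaro_le hdrift x T)
    have hpointwise : ∀ x, Tendsto (fun T => b T x) atTop (𝓝 (min M C)) := by
      intro x
      have h := (ENNReal.Tendsto.mul_const ((tendsto_add_atTop_iff_nat 1).2
        ENNReal.tendsto_inv_nat_nhds_zero) (.inr (hVtop x))).add_const C
      rw [zero_mul, zero_add] at h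
      exact tendsto_const_nhds.min h
    have hlim := tendsto_lintegral_of_dominated_convergence (μ := p.toMeasure)
      (fun _ => (M : ℝ≥0∞)) (fun T => (.of_discrete : Measurable (b T)))
      (fun T => .of_forall fun x => min_le_left _ _) (by simp) (.of_forall hpointwise)
    rw [lintegral_const, measure_univ, mul_one] at hlim
    exact (ge_of_tendsto' hlim hle).trans (min_le_right _ _)
  have hsup : ∀ x, ⨆ M : ℕ, min (f x) M = f x := fun x => by
    rw [← inf_iSup_eq, ENNReal.iSup_natCast, inf_top_eq]
  calc ∫⁻ x, f x ∂p.toMeasure = ∫⁻ x, ⨆ M : ℕ, min (f x) M ∂p.toMeasure := by simp only [hsup]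
    _ = ⨆ M : ℕ, ∫⁻ x, min (f x) M ∂p.toMeasure :=
      lintegral_iSup (fun _ => .of_discrete)
        fun M N h x => min_le_min_left _ (by exact_mod_cast h)
    _ ≤ C := iSup_le truncated

end MarkovChain

section StationaryLaw

open scoped BoundedContinuousFunction

variable {α : Type*} [TopologicalSpace α] [MeasurableSpace α] [BorelSpace α]
  {K : α → PMF α} {V f : α → ℝ≥0∞} {C : ℝ≥0∞}

theorem integral_cesaro (x : α) (T : ℕ) (g : α →ᵇ ℝ) :
    ∫ y, g y ∂cesaro K x T
      = ((T + 1 : ℕ) : ℝ)⁻¹ * ∑ t ∈ Finset.range (T + 1), ∫ y, g y ∂(lawAt K x t).toMeasure := by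
  rw [cesaro, integral_smul_measure, integral_finsetSum_measure fun t _ => g.integrable _,
    smul_eq_mul, ENNReal.toReal_inv, ENNReal.toReal_natCast]

/-- The asymptotic gap between the expectations of `g` along two chains started at the two
components of `z`. -/
def asymptoticGap (K : α → PMF α) (g : α →ᵇ ℝ) (z : α × α) : ℝ≥0∞ :=
  limsup (fun t => ‖∫ y, g y ∂(lawAt K z.1 t).toMeasure
    - ∫ y, g y ∂(lawAt K z.2 t).toMeasure‖ₑ) atTop

theorem enorm_integral_lawAt_sub_le (g : α →ᵇ ℝ) (z : α × α) (t : ℕ) :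
    ‖∫ y, g y ∂(lawAt K z.1 t).toMeasure - ∫ y, g y ∂(lawAt K z.2 t).toMeasure‖ₑ
      ≤ ENNReal.ofReal (‖g‖ + ‖g‖) := by
  rw [← ofReal_norm]
  exact ENNReal.ofReal_le_ofReal ((norm_sub_le _ _).trans
    (add_le_add (g.norm_integral_le_norm _) (g.norm_integral_le_norm _)))

variable [DiscreteTopology α]

/-- The image of `g` under the transition operator of `K`. -/
def transition (K : α → PMF α) (g : α →ᵇ ℝ) : α →ᵇ ℝ :=
  .ofNormedAddCommGroup (fun x => ∫ y, g y ∂(K x).toMeasure) continuous_of_discreteTopology ‖g‖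
    fun _ => g.norm_integral_le_norm _

variable [Countable α]

theorem isTightMeasureSet_cesaro {x : α} (hV : V x ≠ ⊤) (hC : C ≠ ⊤)
    (hf : ∀ M, M ≠ ⊤ → {y | f y ≤ M}.Finite)
    (hdrift : ∀ x, ∫⁻ y, V y ∂(K x).toMeasure + f x ≤ V x + C) :
    IsTightMeasureSet (Set.range (cesaro K x)) := by
  refine isTightMeasureSet_iff_exists_isCompact_measure_compl_le.2 fun ε hε => ?_
  let M := (V x + C) / ε + 1
  have hM : M ≠ ⊤ := ENNReal.add_ne_top.2
    ⟨ENNReal.div_ne_top (ENNReal.add_ne_top.2 ⟨hV, hC⟩) hε.ne', ENNReal.one_ne_top⟩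
  have hM0 : M ≠ 0 := by simp [M]
  refine ⟨{y | f y ≤ M}, (hf M hM).isCompact, ?_⟩
  rintro _ ⟨T, rfl⟩
  have hmean : ∫⁻ y, f y ∂cesaro K x T ≤ V x + C := by
    refine (lintegral_cesaro_le hdrift x T).trans (add_le_add_left (mul_le_of_le_one_left' ?_) _)
    exact ENNReal.inv_le_one.2 (by exact_mod_cast T.succ_pos)
  calc cesaro K x T {y | f y ≤ M}ᶜ ≤ cesaro K x T {y | M ≤ f y} :=
        measure_mono fun y (hy : ¬f y ≤ M) => (not_le.1 hy).le
    _ ≤ (∫⁻ y, f y ∂cesaro K x T) / M :=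
      meas_ge_le_lintegral_div Measurable.of_discrete.aemeasurable hM0 hM
    _ ≤ (V x + C) / M := by gcongr
    _ ≤ ε := by
      refine ENNReal.div_le_of_le_mul ?_
      rw [mul_comm, ← ENNReal.div_le_iff_le_mul (.inl hε.ne') (.inr hM0)]
      exact le_self_add

theorem tendsto_integral_cesaro_transition_sub (x : α) (g : α →ᵇ ℝ) :
    Tendsto (fun T => ∫ y, transition K g y ∂cesaro K x T - ∫ y, g y ∂cesaro K x T) atTop
      (𝓝 0) := by
  have hnext : ∀ t, ∫ y, transition K g y ∂(lawAt K x t).toMeasure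
      = ∫ y, g y ∂(lawAt K x (t + 1)).toMeasure := fun t =>
    (integral_pmf_bind (g.integrable _)).symm
  refine squeeze_zero_norm (fun T => ?_)
    (((tendsto_add_atTop_iff_nat 1).2 tendsto_inv_atTop_nhds_zero_nat).mul_const (2 * ‖g‖) |>.trans
      (by rw [zero_mul]))
  rw [integral_cesaro, integral_cesaro, ← mul_sub, ← Finset.sum_sub_distrib]
  simp only [hnext]
  rw [Finset.sum_range_sub fun t => ∫ y, g y ∂(lawAt K x t).toMeasure, norm_mul, norm_inv,
    RCLike.norm_natCast, two_mul]
  gcongr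
  exact (norm_sub_le _ _).trans (add_le_add (g.norm_integral_le_norm _) (g.norm_integral_le_norm _))

theorem exists_stationary {x : α} (hV : V x ≠ ⊤) (hC : C ≠ ⊤)
    (hf : ∀ M, M ≠ ⊤ → {y | f y ≤ M}.Finite)
    (hdrift : ∀ x, ∫⁻ y, V y ∂(K x).toMeasure + f x ≤ V x + C) : ∃ p : PMF α, p.bind K = p := by
  let average (T : ℕ) : ProbabilityMeasure α := ⟨cesaro K x T, inferInstance⟩
  have hcompact : IsCompact (closure (Set.range average)) := by
    refine isCompact_closure_of_isTightMeasureSet ?_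
    convert isTightMeasureSet_cesaro hV hC hf hdrift
    exact Set.ext fun ν => Set.exists_range_iff
  obtain ⟨μ, -, hμ⟩ := hcompact.ultrafilter_le_nhds ((hyperfilter ℕ).map average)
    (tendsto_principal.2 (.of_forall fun T => subset_closure ⟨T, rfl⟩))
  have hlim (g : α →ᵇ ℝ) : Tendsto (fun T => ∫ y, g y ∂cesaro K x T) (hyperfilter ℕ)
      (𝓝 (∫ y, g y ∂(μ : Measure α))) :=
    ProbabilityMeasure.tendsto_iff_forall_integral_tendsto.1 hμ g
  have hatTop : (hyperfilter ℕ : Filter ℕ) ≤ atTop := Nat.hyperfilter_le_atTop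
  have hinvariant (g : α →ᵇ ℝ) :
      ∫ y, transition K g y ∂(μ : Measure α) = ∫ y, g y ∂(μ : Measure α) :=
    sub_eq_zero.1 (tendsto_nhds_unique ((hlim _).sub (hlim g))
      ((tendsto_integral_cesaro_transition_sub x g).mono_left hatTop))
  refine ⟨(μ : Measure α).toPMF, PMF.toMeasure_injective ?_⟩
  refine ext_of_forall_integral_eq_of_IsFiniteMeasure fun g => ?_
  rw [integral_pmf_bind (g.integrable _), Measure.toPMF_toMeasure]
  exact hinvariant g

theorem asymptoticGap_le_lintegral (g : α →ᵇ ℝ) (z : α × α) :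
    asymptoticGap K g z
      ≤ ∫⁻ y, asymptoticGap K g y ∂(K z.1).toMeasure.prod (K z.2).toMeasure := by
  let G (t : ℕ) : α →ᵇ ℝ := transition (fun x => lawAt K x t) g
  let Q := (K z.1).toMeasure.prod (K z.2).toMeasure
  have hstep (t : ℕ) (x : α) : G (t + 1) x = ∫ y, G t y ∂(K x).toMeasure := by
    change ∫ y, g y ∂(lawAt K x (t + 1)).toMeasure = _
    rw [lawAt_succ_eq_bind_lawAt, integral_pmf_bind (g.integrable _)]
    rfl
  have hgap (t : ℕ) : ‖G (t + 1) z.1 - G (t + 1) z.2‖ₑ ≤ ∫⁻ y, ‖G t y.1 - G t y.2‖ₑ ∂Q := by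
    have heq : G (t + 1) z.1 - G (t + 1) z.2 = ∫ y, G t y.1 - G t y.2 ∂Q := by
      rw [integral_sub (((G t).integrable _).comp_fst _) (((G t).integrable _).comp_snd _),
        integral_fun_fst, integral_fun_snd, hstep, hstep]
      simp
    rw [heq]
    exact enorm_integral_le_lintegral_enorm _
  calc asymptoticGap K g z = limsup (fun t => ‖G (t + 1) z.1 - G (t + 1) z.2‖ₑ) atTop :=
        (limsup_nat_add _ 1).symm
    _ ≤ limsup (fun t => ∫⁻ y, ‖G t y.1 - G t y.2‖ₑ ∂Q) atTop :=
      limsup_le_limsup (.of_forall hgap)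
    _ ≤ ∫⁻ y, asymptoticGap K g y ∂Q :=
      limsup_lintegral_le (fun _ => ENNReal.ofReal (‖g‖ + ‖g‖)) (fun _ => .of_discrete)
        (fun t => .of_forall fun y => enorm_integral_lawAt_sub_le g y t)
        (by simp only [lintegral_const, measure_univ, mul_one]; exact ENNReal.ofReal_ne_top)

theorem lintegral_prod_add_one_le_of_drift (hC : C ≠ ⊤)
    (hdrift : ∀ x, ∫⁻ y, V y ∂(K x).toMeasure + f x ≤ V x + C) {z : α × α}
    (hz : 2 * C + 1 < f z.1 + f z.2) :
    ∫⁻ y, V y.1 + V y.2 ∂(K z.1).toMeasure.prod (K z.2).toMeasure + 1 ≤ V z.1 + V z.2 := by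
  rw [lintegral_add_left .of_discrete, lintegral_prod _ (by fun_prop),
    lintegral_prod _ (by fun_prop)]
  simp only [lintegral_const, measure_univ, mul_one]
  refine (ENNReal.add_le_add_iff_right (by finiteness : 2 * C ≠ ⊤)).1 ?_
  calc _ = ∫⁻ y, V y ∂(K z.1).toMeasure + ∫⁻ y, V y ∂(K z.2).toMeasure + (2 * C + 1) := by ring
    _ ≤ ∫⁻ y, V y ∂(K z.1).toMeasure + ∫⁻ y, V y ∂(K z.2).toMeasure + (f z.1 + f z.2) := by
      gcongr
    _ = (∫⁻ y, V y ∂(K z.1).toMeasure + f z.1) + (∫⁻ y, V y ∂(K z.2).toMeasure + f z.2) := by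
      ring
    _ ≤ (V z.1 + C) + (V z.2 + C) := add_le_add (hdrift _) (hdrift _)
    _ = V z.1 + V z.2 + 2 * C := by ring

/-- Two independent copies of the chain satisfy a drift condition as well, and both ranks can
decrease at the same time. -/
theorem asymptoticGap_eq_zero (g : α →ᵇ ℝ) {rank : α → ℕ} (hV : ∀ x, V x ≠ ⊤) (hC : C ≠ ⊤)
    (hf : ∀ M, M ≠ ⊤ → {y | f y ≤ M}.Finite)
    (hdrift : ∀ x, ∫⁻ y, V y ∂(K x).toMeasure + f x ≤ V x + C)
    (hrank : ∀ x, ∃ y ∈ (K x).support, rank y ≤ rank x - 1)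
    (hroot : ∀ x y, rank x = 0 → rank y = 0 → x = y) (z : α × α) : asymptoticGap K g z = 0 := by
  have hfV : ∀ x, f x ≤ V x + C := fun x => le_add_self.trans (hdrift x)
  have hpair : ∀ M, M ≠ ⊤ → {z : α × α | f z.1 + f z.2 ≤ M}.Finite := fun M hM =>
    ((hf M hM).prod (hf M hM)).subset
      fun z (hz : f z.1 + f z.2 ≤ M) =>
        ⟨(le_self_add.trans hz : f z.1 ≤ M), (le_add_self.trans hz : f z.2 ≤ M)⟩
  refine eq_zero_of_subharmonic_of_drift (B := ENNReal.ofReal (‖g‖ + ‖g‖))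
    (Q := fun z => (K z.1).toMeasure.prod (K z.2).toMeasure) (V := fun z => V z.1 + V z.2)
    (F := {z | f z.1 + f z.2 ≤ 2 * C + 1}) (rank := fun z => max (rank z.1) (rank z.2))
    ENNReal.ofReal_ne_top
    (fun z => limsup_le_of_le (by isBoundedDefault)
      (.of_forall fun t => enorm_integral_lawAt_sub_le g z t))
    (asymptoticGap_le_lintegral g) (fun z => ENNReal.add_ne_top.2 ⟨hV _, hV _⟩)
    (fun M hM => ?_) (hpair _ (by finiteness))
    (fun z hz => lintegral_prod_add_one_le_of_drift hC hdrift (not_le.1 hz)) (fun z hz => ?_)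
    (fun z hz => ?_) z
  · refine (hpair (M + 2 * C) (by finiteness)).subset fun z (hz : V z.1 + V z.2 ≤ M) => ?_
    calc f z.1 + f z.2 ≤ (V z.1 + C) + (V z.2 + C) := add_le_add (hfV _) (hfV _)
      _ = (V z.1 + V z.2) + 2 * C := by ring
      _ ≤ M + 2 * C := by gcongr
  · obtain ⟨y₁, hy₁, hr₁⟩ := hrank z.1
    obtain ⟨y₂, hy₂, hr₂⟩ := hrank z.2
    refine ⟨(y₁, y₂), ?_, by dsimp only at hz ⊢; omega⟩
    rw [← Set.singleton_prod_singleton, Measure.prod_prod,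
      PMF.toMeasure_apply_singleton _ _ .of_discrete,
      PMF.toMeasure_apply_singleton _ _ .of_discrete]
    exact mul_ne_zero hy₁ hy₂
  · have heq : z.1 = z.2 := hroot _ _ (by omega) (by omega)
    simp [heq]

theorem tendsto_integral_lawAt (g : α →ᵇ ℝ) {p : PMF α} (hp : p.bind K = p)
    (hgap : ∀ z, asymptoticGap K g z = 0) (x : α) :
    Tendsto (fun t => ∫ y, g y ∂(lawAt K x t).toMeasure) atTop (𝓝 (∫ y, g y ∂p.toMeasure)) := by
  let G (t : ℕ) : α →ᵇ ℝ := transition (fun x => lawAt K x t) g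
  have hpair (y : α) : Tendsto (fun t => G t x - G t y) atTop (𝓝 0) := by
    refine tendsto_zero_iff_enorm_tendsto_zero.2 ?_
    exact tendsto_of_le_liminf_of_limsup_le zero_le (hgap (x, y)).le
  have hmean (t : ℕ) : ∫ y, G t x - G t y ∂p.toMeasure = G t x - ∫ y, g y ∂p.toMeasure := by
    rw [integral_sub (integrable_const _) ((G t).integrable _), integral_const, probReal_univ,
      one_smul]
    nth_rewrite 2 [← bind_lawAt hp t]
    rw [integral_pmf_bind (g.integrable _)]
    rfl
  have hlim : Tendsto (fun t => ∫ y, G t x - G t y ∂p.toMeasure) atTop (𝓝 0) := by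
    have h := tendsto_integral_of_dominated_convergence (μ := p.toMeasure)
      (fun _ => ‖g‖ + ‖g‖) (fun t => Measurable.of_discrete.aestronglyMeasurable)
      (integrable_const _) (fun t => .of_forall fun y => (norm_sub_le _ _).trans
        (add_le_add (g.norm_integral_le_norm (lawAt K x t).toMeasure)
          (g.norm_integral_le_norm (lawAt K y t).toMeasure))) (.of_forall hpair)
    rwa [integral_zero] at h
  simp only [hmean] at hlim
  exact tendsto_sub_nhds_zero_iff.1 hlim

end StationaryLaw

section SquareDrift

variable {α : Type*} [MeasurableSpace α] {K : α → PMF α} {w : α → ℝ}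
  {δ C L : ℝ}

/-- The drift condition for a nonnegative function `w` along the chain `K`: the jumps of `w` are
bounded by `L`, and `w²` decreases on average by `δ w`, up to a constant `C`. -/
structure SqDrift (K : α → PMF α) (w : α → ℝ) (δ C L : ℝ) : Prop where
  nonneg : ∀ x, 0 ≤ w x
  abs_sub_le : ∀ x, ∀ y ∈ (K x).support, |w y - w x| ≤ L
  drift : ∀ x, ∫ y, w y ^ 2 ∂(K x).toMeasure ≤ w x ^ 2 - δ * w x + C

/-- A bound on the stationary mean of `w²` under the drift condition `SqDrift K w δ C L`, when
`0 < δ` and `0 ≤ C`. -/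
def secondMomentBound (δ C L : ℝ) : ℝ := (2 * C + 6 * L ^ 2 + 1) ^ 3 / (2 * δ) ^ 2 + 3 * L ^ 4

theorem secondMomentBound_nonneg (hC : 0 ≤ C) : 0 ≤ secondMomentBound δ C L := by
  unfold secondMomentBound
  positivity

theorem mul_sq_sub_mul_pow_three_le {b c x : ℝ} (hb : 0 ≤ b) (hc : 0 < c) (hx : 0 ≤ x) :
    b * x ^ 2 - c * x ^ 3 ≤ b ^ 3 / c ^ 2 := by
  rcases le_total (c * x) b with hcx | hcx
  · have hxb : x ≤ b / c := (le_div_iff₀' hc).2 hcx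
    calc b * x ^ 2 - c * x ^ 3 ≤ b * x ^ 2 := sub_le_self _ (by positivity)
      _ ≤ b * (b / c) ^ 2 := by gcongr
      _ = b ^ 3 / c ^ 2 := by ring
  · calc b * x ^ 2 - c * x ^ 3 = x ^ 2 * (b - c * x) := by ring
      _ ≤ 0 := mul_nonpos_of_nonneg_of_nonpos (sq_nonneg x) (sub_nonpos.2 hcx)
      _ ≤ b ^ 3 / c ^ 2 := by positivity

namespace SqDrift

theorem abs_sq_sub_sq_le (h : SqDrift K w δ C L) {x y : α} (hy : y ∈ (K x).support) :
    |w y ^ 2 - w x ^ 2| ≤ L * (2 * w x + L) := by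
  have hjump := h.abs_sub_le x y hy
  have hsum : w y + w x ≤ 2 * w x + L := by linarith [(abs_le.1 hjump).2]
  have hL : 0 ≤ L := (abs_nonneg _).trans hjump
  rw [sq_sub_sq, mul_comm, abs_mul, abs_of_nonneg (add_nonneg (h.nonneg y) (h.nonneg x))]
  exact mul_le_mul hjump hsum (add_nonneg (h.nonneg y) (h.nonneg x)) hL

variable [DiscreteMeasurableSpace α]

theorem integrable_comp (h : SqDrift K w δ C L) {φ : ℝ → ℝ} (hφ : Continuous φ) (x : α) :
    Integrable (fun y => φ (w y)) (K x).toMeasure := by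
  obtain ⟨B, hB⟩ := (isCompact_Icc (a := w x - L) (b := w x + L)).exists_bound_of_continuousOn
    hφ.continuousOn
  refine integrable_of_bounded_on_support (B := B) fun y hy => hB _ ?_
  have hjump := abs_le.1 (h.abs_sub_le x y hy)
  constructor <;> linarith

theorem integral_pow_four_le (h : SqDrift K w δ C L) (hδ : 0 < δ) (hC : 0 ≤ C) (x : α) :
    ∫ y, w y ^ 4 ∂(K x).toMeasure + w x ^ 2 ≤ w x ^ 4 + secondMomentBound δ C L := by
  have hpow (k : ℕ) : Integrable (fun y => w y ^ k) (K x).toMeasure :=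
    h.integrable_comp (continuous_pow k) x
  have hpoint : ∀ᵐ y ∂(K x).toMeasure,
      w y ^ 4 ≤ (L * (2 * w x + L)) ^ 2 + 2 * w x ^ 2 * w y ^ 2 - w x ^ 4 := by
    refine ae_toMeasure_iff.2 fun y hy => ?_
    have hsq : (w y ^ 2 - w x ^ 2) ^ 2 ≤ (L * (2 * w x + L)) ^ 2 :=
      sq_le_sq.2 ((h.abs_sq_sub_sq_le hy).trans (le_abs_self _))
    linear_combination hsq
  have hmean : ∫ y, w y ^ 4 ∂(K x).toMeasure
      ≤ (L * (2 * w x + L)) ^ 2 + 2 * w x ^ 2 * ∫ y, w y ^ 2 ∂(K x).toMeasure - w x ^ 4 := by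
    refine (integral_mono_ae (hpow 4) (by fun_prop) hpoint).trans_eq ?_
    rw [integral_sub (by fun_prop) (by fun_prop), integral_add (by fun_prop) (by fun_prop),
      integral_const_mul]
    simp only [integral_const, probReal_univ, one_smul]
  have hdrift := mul_le_mul_of_nonneg_left (h.drift x) (by positivity : 0 ≤ 2 * w x ^ 2)
  have hcubic := mul_sq_sub_mul_pow_three_le (b := 2 * C + 6 * L ^ 2 + 1) (by positivity)
    (by positivity : 0 < 2 * δ) (h.nonneg x)
  have hAMGM : 0 ≤ 2 * L ^ 2 * (w x - L) ^ 2 := by positivity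
  unfold secondMomentBound
  linear_combination hmean + hdrift + hcubic + hAMGM

theorem lintegral_pow_four_le (h : SqDrift K w δ C L) (hδ : 0 < δ) (hC : 0 ≤ C) (x : α) :
    ∫⁻ y, ENNReal.ofReal (w y ^ 4) ∂(K x).toMeasure + ENNReal.ofReal (w x ^ 2)
      ≤ ENNReal.ofReal (w x ^ 4) + ENNReal.ofReal (secondMomentBound δ C L) := by
  rw [← ofReal_integral_eq_lintegral_ofReal (h.integrable_comp (continuous_pow 4) x)
    (.of_forall fun y => by positivity), ← ENNReal.ofReal_add (by positivity) (by positivity),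
    ← ENNReal.ofReal_add (by positivity) (secondMomentBound_nonneg hC)]
  exact ENNReal.ofReal_le_ofReal (h.integral_pow_four_le hδ hC x)

variable [Countable α] {p : PMF α}

theorem lintegral_sq_le (h : SqDrift K w δ C L) (hδ : 0 < δ) (hC : 0 ≤ C) (hp : p.bind K = p) :
    ∫⁻ x, ENNReal.ofReal (w x ^ 2) ∂p.toMeasure ≤ ENNReal.ofReal (secondMomentBound δ C L) :=
  lintegral_le_of_stationary (fun _ => ENNReal.ofReal_ne_top) (h.lintegral_pow_four_le hδ hC) hp

theorem memLp_two (h : SqDrift K w δ C L) (hδ : 0 < δ) (hC : 0 ≤ C) (hp : p.bind K = p) :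
    MemLp w 2 p.toMeasure := by
  refine (memLp_two_iff_integrable_sq Measurable.of_discrete.aestronglyMeasurable).2
    ⟨Measurable.of_discrete.aestronglyMeasurable, ?_⟩
  rw [hasFiniteIntegral_iff_ofReal (.of_forall fun x => sq_nonneg _)]
  exact (h.lintegral_sq_le hδ hC hp).trans_lt ENNReal.ofReal_lt_top

theorem integral_sq_le (h : SqDrift K w δ C L) (hδ : 0 < δ) (hC : 0 ≤ C) (hp : p.bind K = p) :
    ∫ x, w x ^ 2 ∂p.toMeasure ≤ secondMomentBound δ C L := by
  rw [integral_eq_lintegral_of_nonneg_ae (.of_forall fun x => sq_nonneg _)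
    Measurable.of_discrete.aestronglyMeasurable]
  exact ENNReal.toReal_le_of_le_ofReal (secondMomentBound_nonneg hC) (h.lintegral_sq_le hδ hC hp)

end SqDrift

end SquareDrift

section SteadyState

variable {n : ℕ} {K : QueueState n → PMF (QueueState n)}

theorem isSteadyState_iff {p : PMF (QueueState n)} :
    IsSteadyState K p ↔ p.bind K = p ∧ ∀ q (g : BoundedContinuousFunction (QueueState n) ℝ),
      Tendsto (fun t => ∫ x, g x ∂(lawAt K q t).toMeasure) atTop (𝓝 (∫ x, g x ∂p.toMeasure)) :=
  ⟨fun h => ⟨h.stationary, fun q =>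
      ProbabilityMeasure.tendsto_iff_forall_integral_tendsto.1 (h.tendsto q)⟩,
    fun h => ⟨h.1, fun q => ProbabilityMeasure.tendsto_iff_forall_integral_tendsto.2 (h.2 q)⟩⟩

theorem IsSteadyState.unique {p p' : PMF (QueueState n)} (h : IsSteadyState K p)
    (h' : IsSteadyState K p') : p = p' := by
  have hlim : toProb p = toProb p' := tendsto_nhds_unique (h.tendsto 0) (h'.tendsto 0)
  exact PMF.toMeasure_injective (congrArg Subtype.val hlim)

theorem exists_isSteadyState {V f : QueueState n → ℝ≥0∞} {C : ℝ≥0∞} {rank : QueueState n → ℕ}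
    (hV : ∀ x, V x ≠ ⊤) (hC : C ≠ ⊤) (hf : ∀ M, M ≠ ⊤ → {y | f y ≤ M}.Finite)
    (hdrift : ∀ x, ∫⁻ y, V y ∂(K x).toMeasure + f x ≤ V x + C)
    (hrank : ∀ x, ∃ y ∈ (K x).support, rank y ≤ rank x - 1)
    (hroot : ∀ x y, rank x = 0 → rank y = 0 → x = y) : ∃ p, IsSteadyState K p := by
  obtain ⟨p, hp⟩ := exists_stationary (hV 0) hC hf hdrift
  exact ⟨p, isSteadyState_iff.2 ⟨hp, fun q g =>
    tendsto_integral_lawAt g hp (asymptoticGap_eq_zero g hV hC hf hdrift hrank hroot) q⟩⟩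

end SteadyState

section Permutations

variable {ι : Type*}

theorem exists_perm_apply_eq_apply_eq {i j k l : ι} (hik : i ≠ k) (hjl : j ≠ l) :
    ∃ π : Equiv.Perm ι, π i = j ∧ π k = l := by
  classical
  have hj : j ≠ Equiv.swap i j k := fun h =>
    hik ((Equiv.swap i j).injective ((Equiv.swap_apply_left i j).trans h))
  refine ⟨(Equiv.swap i j).trans (Equiv.swap (Equiv.swap i j k) l), ?_, ?_⟩
  · rw [Equiv.trans_apply, Equiv.swap_apply_left, Equiv.swap_apply_of_ne_of_ne hj hjl]
  · rw [Equiv.trans_apply, Equiv.swap_apply_left]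

theorem exists_latin_square [Finite ι] [Nonempty ι] :
    ∃ (σ : ι → Equiv.Perm ι) (k₀ : ι), σ k₀ = 1 ∧ ∀ i, Function.Bijective fun k => σ k i := by
  have := Fintype.ofFinite ι
  have : NeZero (Fintype.card ι) := ⟨Fintype.card_ne_zero⟩
  let e := Fintype.equivFin ι
  refine ⟨fun k => (e.trans (Equiv.addRight (e k))).trans e.symm, e.symm 0, ?_, fun i => ?_⟩
  · ext i
    simp
  · exact ((e.trans (Equiv.addLeft (e i))).trans e.symm).bijective

variable [Fintype ι] {x : ι → ι → ℝ} {M : ℝ}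

theorem sum_add_le_card_mul [Nonempty ι] (hM : ∀ σ : Equiv.Perm ι, ∑ i, x i (σ i) ≤ M)
    (π : Equiv.Perm ι) : ∑ i, ∑ j, x i j + M ≤ Fintype.card ι * M + ∑ i, x i (π i) := by
  classical
  obtain ⟨σ, k₀, hk₀, hσ⟩ := exists_latin_square (ι := ι)
  have hcover : ∑ i, ∑ j, x i j = ∑ k, ∑ i, x i (σ k (π i)) := by
    rw [Finset.sum_comm (s := Finset.univ (α := ι)) (f := fun k i => x i (σ k (π i)))]
    exact Finset.sum_congr rfl fun i _ =>
      ((Equiv.ofBijective _ (hσ (π i))).sum_comp fun j => x i j).symm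
  have hrest : ∑ k ∈ Finset.univ.erase k₀, ∑ i, x i (σ k (π i))
      ≤ ∑ _k ∈ Finset.univ.erase k₀, M := Finset.sum_le_sum fun k _ => hM (π.trans (σ k))
  have hcard : ∑ _k ∈ Finset.univ.erase k₀, M + M = Fintype.card ι * M := by
    rw [Finset.sum_erase_add _ _ (Finset.mem_univ k₀), Finset.sum_const, Finset.card_univ,
      nsmul_eq_mul]
  rw [hcover, ← Finset.add_sum_erase _ _ (Finset.mem_univ k₀), hk₀]
  simp only [Equiv.Perm.one_apply]
  linarith

theorem sum_le_card_mul (hM : ∀ σ : Equiv.Perm ι, ∑ i, x i (σ i) ≤ M) :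
    ∑ i, ∑ j, x i j ≤ Fintype.card ι * M := by
  cases isEmpty_or_nonempty ι
  · simp
  · linarith [sum_add_le_card_mul hM 1, hM 1]

theorem sum_perm_sub_sum_swap_trans [DecidableEq ι] (x : ι → ι → ℝ) (π : Equiv.Perm ι) {i k : ι}
    (hik : i ≠ k) : ∑ m, x m (π m) - ∑ m, x m ((Equiv.swap i k).trans π m)
      = x i (π i) + x k (π k) - x i (π k) - x k (π i) := by
  rw [← Finset.sum_sub_distrib, Fintype.sum_eq_add i k hik]
  · simp only [Equiv.trans_apply, Equiv.swap_apply_left, Equiv.swap_apply_right]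
    ring
  · rintro m ⟨hmi, hmk⟩
    rw [Equiv.trans_apply, Equiv.swap_apply_of_ne_of_ne hmi hmk, sub_self]

theorem abs_cross_le (hM : ∀ σ : Equiv.Perm ι, ∑ i, x i (σ i) ≤ M) (i j k l : ι) :
    |x i j + x k l - x i l - x k j| ≤ Fintype.card ι * M - ∑ i, ∑ j, x i j := by
  classical
  have : Nonempty ι := ⟨i⟩
  have hsum := sum_le_card_mul hM
  rcases eq_or_ne i k with rfl | hik
  · rw [show x i j + x i l - x i l - x i j = 0 by ring, abs_zero]
    linarith
  rcases eq_or_ne j l with rfl | hjl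
  · rw [show x i j + x k j - x i j - x k j = 0 by ring, abs_zero]
    linarith
  obtain ⟨π, rfl, rfl⟩ := exists_perm_apply_eq_apply_eq hik hjl
  rw [← sum_perm_sub_sum_swap_trans x π hik, abs_le]
  have hπ := sum_add_le_card_mul hM π
  have hswap := sum_add_le_card_mul hM ((Equiv.swap i k).trans π)
  constructor <;> linarith [hM π, hM ((Equiv.swap i k).trans π)]

theorem sum_block_le_card_mul (hx : ∀ i j, 0 ≤ x i j)
    (hM : ∀ σ : Equiv.Perm ι, ∑ i, x i (σ i) ≤ M) (J : Finset ι) :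
    ∑ i ∈ J, ∑ j ∈ J, x i j ≤ J.card * M := by
  classical
  have hJ (σ : Equiv.Perm J) : ∑ i : J, x i (σ i) ≤ M := by
    calc ∑ i : J, x i (σ i) = ∑ i : J, x i (Equiv.Perm.ofSubtype σ i) := by
          simp only [Equiv.Perm.ofSubtype_apply_coe]
      _ = ∑ i ∈ J, x i (Equiv.Perm.ofSubtype σ i) :=
          Finset.sum_coe_sort J fun i => x i (Equiv.Perm.ofSubtype σ i)
      _ ≤ ∑ i, x i (Equiv.Perm.ofSubtype σ i) :=
          Finset.sum_le_sum_of_subset_of_nonneg (Finset.subset_univ J) fun _ _ _ => hx _ _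
      _ ≤ M := hM _
  have hblock := sum_le_card_mul (x := fun i j : J => x i j) hJ
  rw [Fintype.card_coe] at hblock
  rw [← Finset.sum_coe_sort J fun i => ∑ j ∈ J, x i j]
  simpa only [Finset.sum_coe_sort J (x _)] using hblock

theorem eq_zero_of_diag_eq_zero (hx : ∀ i j, 0 ≤ x i j)
    (hM : ∀ σ : Equiv.Perm ι, ∑ i, x i (σ i) ≤ ∑ i, x i i) {i j : ι} (hi : x i i = 0)
    (hj : x j j = 0) : x i j = 0 := by
  classical
  rcases eq_or_ne i j with rfl | hij
  · exact hi
  · have hswap := sum_perm_sub_sum_swap_trans x 1 hij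
    simp only [Equiv.Perm.one_apply, hi, hj] at hswap
    linarith [hM ((Equiv.swap i j).trans 1), hx i j, hx j i]

theorem card_mul_sum_cross_le (hx : ∀ i j, 0 ≤ x i j)
    (hM : ∀ σ : Equiv.Perm ι, ∑ i, x i (σ i) ≤ ∑ i, x i i) {J : Finset ι}
    (hJ : ∀ i ∉ J, x i i = 0) :
    (Fintype.card ι : ℝ) * (∑ i ∈ J, ∑ j, x i j + ∑ j ∈ J, ∑ i, x i j)
      ≤ (Fintype.card ι : ℝ) ^ 2 * ∑ i ∈ J, x i i + J.card * ∑ i, ∑ j, x i j := by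
  classical
  have hdiag : ∑ i, x i i = ∑ i ∈ J, x i i :=
    (Finset.sum_subset (Finset.subset_univ J) fun i _ hi => hJ i hi).symm
  have hrows : ∑ i, ∑ j, x i j = ∑ i ∈ J, ∑ j, x i j + ∑ i ∈ Jᶜ, ∑ j ∈ J, x i j := by
    rw [← Finset.sum_add_sum_compl J]
    congr 1
    refine Finset.sum_congr rfl fun i hi =>
      (Finset.sum_subset (Finset.subset_univ J) fun j _ hj => ?_).symm
    exact eq_zero_of_diag_eq_zero hx hM (hJ i (Finset.mem_compl.1 hi)) (hJ j hj)
  have hcols : ∑ j ∈ J, ∑ i, x i j = ∑ i ∈ J, ∑ j ∈ J, x i j + ∑ i ∈ Jᶜ, ∑ j ∈ J, x i j := by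
    rw [Finset.sum_comm, Finset.sum_add_sum_compl J]
  have hblock := sum_block_le_card_mul hx hM J
  have htotal := sum_le_card_mul hM
  have hcard : (J.card : ℝ) ≤ Fintype.card ι := by exact_mod_cast J.card_le_univ
  rw [← hdiag]
  linear_combination (Fintype.card ι : ℝ) * hblock - (Fintype.card ι : ℝ) * hrows
    + (Fintype.card ι : ℝ) * hcols + (Fintype.card ι - J.card : ℝ) * htotal

end Permutations

section Margins

/-- Real matrices indexed by `ι`, with the Frobenius inner product. -/
abbrev MatrixSpace (ι : Type*) : Type _ := EuclideanSpace ℝ (ι × ι)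

variable {ι : Type*} [Fintype ι] (x y : MatrixSpace ι)

/-- The sum of row `i`. -/
def rowSum (i : ι) : ℝ := ∑ j, x (i, j)

/-- The sum of column `j`. -/
def colSum (j : ι) : ℝ := ∑ i, x (i, j)

/-- The sum of all entries. -/
def total : ℝ := ∑ i, ∑ j, x (i, j)

theorem inner_eq_sum_sum : ⟪x, y⟫_ℝ = ∑ i, ∑ j, x (i, j) * y (i, j) := by
  rw [PiLp.inner_apply, Fintype.sum_prod_type]
  simp only [RCLike.inner_apply, conj_trivial, mul_comm]

theorem sum_rowSum : ∑ i, rowSum x i = total x := rfl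

theorem sum_colSum : ∑ j, colSum x j = total x := Finset.sum_comm

theorem total_add : total (x + y) = total x + total y := by
  simp only [total, PiLp.add_apply, Finset.sum_add_distrib]

theorem total_sub : total (x - y) = total x - total y := by
  simp only [total, PiLp.sub_apply, Finset.sum_sub_distrib]

theorem norm_le_total {x : MatrixSpace ι} (hx : ∀ i j, 0 ≤ x (i, j)) : ‖x‖ ≤ total x := by
  have h : ‖x‖ ^ 2 ≤ total x ^ 2 := by
    rw [EuclideanSpace.real_norm_sq_eq, total, ← Fintype.sum_prod_type]
    exact Finset.sum_sq_le_sq_sum_of_nonneg fun p _ => hx p.1 p.2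
  exact le_of_sq_le_sq h (Finset.sum_nonneg fun i _ => Finset.sum_nonneg fun j _ => hx i j)

variable (ι) in
/-- The all-ones matrix. -/
def ones : MatrixSpace ι := WithLp.toLp 2 fun _ => 1

theorem inner_ones : ⟪x, ones ι⟫_ℝ = total x := by
  simp only [inner_eq_sum_sum, ones, mul_one, total]

variable (ι) in
/-- The matrices all of whose row and column sums vanish. Its orthogonal complement is spanned by
the indicators of the rows and of the columns. -/
def zeroMargins : Submodule ℝ (MatrixSpace ι) where
  carrier := {x | (∀ i, rowSum x i = 0) ∧ ∀ j, colSum x j = 0}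
  zero_mem' := by simp [rowSum, colSum]
  add_mem' := by
    rintro x y ⟨hxr, hxc⟩ ⟨hyr, hyc⟩
    refine ⟨fun i => ?_, fun j => ?_⟩
    · simpa [rowSum, Finset.sum_add_distrib] using congrArg₂ (· + ·) (hxr i) (hyr i)
    · simpa [colSum, Finset.sum_add_distrib] using congrArg₂ (· + ·) (hxc j) (hyc j)
  smul_mem' := by
    rintro c x ⟨hxr, hxc⟩
    refine ⟨fun i => ?_, fun j => ?_⟩
    · simpa [rowSum, Finset.mul_sum] using congrArg (c * ·) (hxr i)
    · simpa [colSum, Finset.mul_sum] using congrArg (c * ·) (hxc j)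

theorem mem_orthogonal_zeroMargins {x : MatrixSpace ι} {a b : ι → ℝ}
    (hx : ∀ i j, x (i, j) = a i + b j) : x ∈ (zeroMargins ι)ᗮ := by
  rintro y ⟨hrow, hcol⟩
  simp only [inner_eq_sum_sum, hx, mul_add, Finset.sum_add_distrib]
  rw [Finset.sum_comm (f := fun i j => y (i, j) * b j)]
  simp only [← Finset.sum_mul]
  simp only [rowSum, colSum] at hrow hcol
  simp [hrow, hcol]

theorem ones_mem_orthogonal_zeroMargins : ones ι ∈ (zeroMargins ι)ᗮ :=
  mem_orthogonal_zeroMargins (a := 1) (b := 0) fun _ _ => by simp [ones]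

theorem total_starProjection_zeroMargins : total ((zeroMargins ι).starProjection x) = 0 := by
  rw [← inner_ones]
  exact (Submodule.mem_orthogonal _ _).1 ones_mem_orthogonal_zeroMargins _
    (Submodule.starProjection_apply_mem _ x)

variable [Nonempty ι]

theorem starProjection_zeroMargins_apply (i j : ι) :
    (zeroMargins ι).starProjection x (i, j) = x (i, j) - rowSum x i / Fintype.card ι
      - colSum x j / Fintype.card ι + total x / Fintype.card ι ^ 2 := by
  let z : MatrixSpace ι := WithLp.toLp 2 fun p => x p - rowSum x p.1 / Fintype.card ι
    - colSum x p.2 / Fintype.card ι + total x / Fintype.card ι ^ 2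
  have hz : z ∈ zeroMargins ι := by
    constructor <;> intro k <;>
    · simp only [rowSum, colSum, z, Finset.sum_add_distrib, Finset.sum_sub_distrib,
        ← Finset.sum_div, ← total.eq_def, Finset.sum_const, Finset.card_univ, nsmul_eq_mul]
      try rw [Finset.sum_comm, ← total.eq_def]
      field_simp
      ring
  have hxz : x - z ∈ (zeroMargins ι)ᗮ :=
    mem_orthogonal_zeroMargins (a := fun i => rowSum x i / Fintype.card ι)
      (b := fun j => colSum x j / Fintype.card ι - total x / Fintype.card ι ^ 2)
      fun i j => by simp only [z, PiLp.sub_apply]; ring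
  rw [Submodule.eq_starProjection_of_mem_orthogonal hz hxz]

theorem sum_starProjection_zeroMargins (s : Equiv.Perm ι) :
    ∑ i, (zeroMargins ι).starProjection x (i, s i)
      = ∑ i, x (i, s i) - total x / Fintype.card ι := by
  simp only [starProjection_zeroMargins_apply, Finset.sum_add_distrib, Finset.sum_sub_distrib,
    ← Finset.sum_div, Equiv.sum_comp s (colSum x), sum_rowSum, sum_colSum, Finset.sum_const,
    Finset.card_univ, nsmul_eq_mul]
  field_simp
  ring

theorem norm_sq_starProjection_orthogonal_zeroMargins :
    ‖(zeroMargins ι)ᗮ.starProjection x‖ ^ 2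
      = (∑ i, rowSum x i ^ 2 + ∑ j, colSum x j ^ 2) / Fintype.card ι
        - total x ^ 2 / Fintype.card ι ^ 2 := by
  have hinner : ‖(zeroMargins ι)ᗮ.starProjection x‖ ^ 2
      = ⟪x, (zeroMargins ι)ᗮ.starProjection x⟫_ℝ := by
    rw [real_inner_comm]
    exact ((zeroMargins ι)ᗮ.re_inner_starProjection_eq_normSq x).symm
  have hrow : ∑ i, ∑ j, x (i, j) * rowSum x i = ∑ i, rowSum x i ^ 2 := by
    simp only [← Finset.sum_mul, rowSum, sq]
  have hcol : ∑ i, ∑ j, x (i, j) * colSum x j = ∑ j, colSum x j ^ 2 := by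
    rw [Finset.sum_comm]
    simp only [← Finset.sum_mul, colSum, sq]
  have hentry (i j : ι) : (zeroMargins ι)ᗮ.starProjection x (i, j) = rowSum x i / Fintype.card ι
      + colSum x j / Fintype.card ι - total x / Fintype.card ι ^ 2 := by
    rw [Submodule.starProjection_orthogonal_val, PiLp.sub_apply, starProjection_zeroMargins_apply]
    ring
  simp only [hinner, inner_eq_sum_sum, hentry, mul_add, mul_sub, Finset.sum_add_distrib,
    Finset.sum_sub_distrib, ← mul_div_assoc, ← Finset.sum_div, hrow, hcol]
  simp only [← Finset.sum_mul, ← total.eq_def]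
  ring

variable {x} {M : ℝ}

theorem abs_starProjection_zeroMargins_le (hM : ∀ σ : Equiv.Perm ι, ∑ i, x (i, σ i) ≤ M)
    (i j : ι) : |(zeroMargins ι).starProjection x (i, j)| ≤ Fintype.card ι * M - total x := by
  have haverage : (Fintype.card ι : ℝ) ^ 2 * (zeroMargins ι).starProjection x (i, j)
      = ∑ k, ∑ l, (x (i, j) + x (k, l) - x (i, l) - x (k, j)) := by
    rw [starProjection_zeroMargins_apply]
    simp only [Finset.sum_sub_distrib, Finset.sum_add_distrib, Finset.sum_const, Finset.card_univ,
      nsmul_eq_mul, ← Finset.mul_sum, rowSum, colSum, total]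
    field_simp
    ring
  have hle : |(Fintype.card ι : ℝ) ^ 2 * (zeroMargins ι).starProjection x (i, j)|
      ≤ (Fintype.card ι : ℝ) ^ 2 * (Fintype.card ι * M - total x) := by
    calc |(Fintype.card ι : ℝ) ^ 2 * (zeroMargins ι).starProjection x (i, j)|
        ≤ ∑ k, ∑ l, |x (i, j) + x (k, l) - x (i, l) - x (k, j)| := by
          rw [haverage]
          exact (Finset.abs_sum_le_sum_abs _ _).trans
            (Finset.sum_le_sum fun k _ => Finset.abs_sum_le_sum_abs _ _)
      _ ≤ ∑ _k : ι, ∑ _l : ι, (Fintype.card ι * M - total x) :=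
          Finset.sum_le_sum fun k _ => Finset.sum_le_sum fun l _ =>
            abs_cross_le (x := fun i j => x (i, j)) hM i j k l
      _ = (Fintype.card ι : ℝ) ^ 2 * (Fintype.card ι * M - total x) := by
          simp only [Finset.sum_const, Finset.card_univ, nsmul_eq_mul]
          ring
  rw [abs_mul, abs_of_nonneg (by positivity)] at hle
  exact le_of_mul_le_mul_left hle (by positivity)

theorem norm_starProjection_zeroMargins_le (hM : ∀ σ : Equiv.Perm ι, ∑ i, x (i, σ i) ≤ M) :
    ‖(zeroMargins ι).starProjection x‖ ≤ Fintype.card ι * (Fintype.card ι * M - total x) := by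
  have hnonneg : 0 ≤ Fintype.card ι * M - total x :=
    sub_nonneg.2 (sum_le_card_mul (x := fun i j => x (i, j)) hM)
  refine le_of_sq_le_sq ?_ (by positivity)
  calc ‖(zeroMargins ι).starProjection x‖ ^ 2
      ≤ ∑ _p : ι × ι, (Fintype.card ι * M - total x) ^ 2 := by
        rw [EuclideanSpace.real_norm_sq_eq]
        exact Finset.sum_le_sum fun p _ =>
          sq_le_sq.2 ((abs_starProjection_zeroMargins_le hM p.1 p.2).trans (le_abs_self _))
    _ = (Fintype.card ι * (Fintype.card ι * M - total x)) ^ 2 := by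
        simp only [Finset.sum_const, Finset.card_univ, Fintype.card_prod, nsmul_eq_mul,
          Nat.cast_mul]
        ring

theorem sum_starProjection_zeroMargins_nonneg (hx : ∀ i j, 0 ≤ x (i, j)) {s : Equiv.Perm ι}
    (hs : ∀ σ : Equiv.Perm ι, ∑ i, x (i, σ i) ≤ ∑ i, x (i, s i)) :
    0 ≤ ∑ i with x (i, s i) ≠ 0, (zeroMargins ι).starProjection x (i, s i) := by
  let J := Finset.univ.filter fun i => x (i, s i) ≠ 0
  have hcross := card_mul_sum_cross_le (x := fun i j => x (i, s j)) (J := J)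
    (fun i j => hx i (s j)) (fun σ => hs (σ.trans s)) (by simp [J])
  have hrow (i : ι) : ∑ j, x (i, s j) = rowSum x i := Equiv.sum_comp s fun j => x (i, j)
  have hcol (j : ι) : ∑ i, x (i, s j) = colSum x (s j) := rfl
  simp only [hrow, hcol, sum_rowSum] at hcross
  have hexpand : (Fintype.card ι : ℝ) ^ 2 * ∑ i ∈ J, (zeroMargins ι).starProjection x (i, s i)
      = Fintype.card ι ^ 2 * ∑ i ∈ J, x (i, s i) + J.card * total x
        - Fintype.card ι * (∑ i ∈ J, rowSum x i + ∑ i ∈ J, colSum x (s i)) := by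
    simp only [starProjection_zeroMargins_apply, Finset.sum_add_distrib, Finset.sum_sub_distrib,
      ← Finset.sum_div, Finset.sum_const, nsmul_eq_mul]
    field_simp
    ring
  have hscaled :
      0 ≤ (Fintype.card ι : ℝ) ^ 2 * ∑ i ∈ J, (zeroMargins ι).starProjection x (i, s i) := by
    linarith
  exact nonneg_of_mul_nonneg_right hscaled (by positivity)

end Margins

section PermutationMatrices

variable {ι : Type*} [Fintype ι] [DecidableEq ι]

/-- The permutation matrix of `s`. -/
def permMatrix (s : Equiv.Perm ι) : MatrixSpace ι :=
  WithLp.toLp 2 fun p => if s p.1 = p.2 then 1 else 0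

theorem inner_permMatrix (x : MatrixSpace ι) (s : Equiv.Perm ι) :
    ⟪x, permMatrix s⟫_ℝ = ∑ i, x (i, s i) := by
  simp [inner_eq_sum_sum, permMatrix]

variable (s : Equiv.Perm ι)

theorem rowSum_permMatrix (i : ι) : rowSum (permMatrix s) i = 1 := by simp [rowSum, permMatrix]

theorem colSum_permMatrix (j : ι) : colSum (permMatrix s) j = 1 := by
  simp [colSum, permMatrix, ← Equiv.eq_symm_apply]

theorem total_permMatrix : total (permMatrix s) = Fintype.card ι := by
  simp [← sum_rowSum, rowSum_permMatrix]

end PermutationMatrices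

section ArrivalMoments

open ProbabilityTheory

variable {n : ℕ}

/-- The matrix of the numbers of arriving packets. -/
def arrivalMatrix (a : Arrivals n) : MatrixSpace (Fin n) :=
  WithLp.toLp 2 fun p => if a p.1 p.2 then 1 else 0

variable (rate : Fin n → Fin n → unitInterval)

theorem map_arrivalLaw :
    (arrivalLaw rate).toMeasure.map (fun a (p : Fin n × Fin n) => a p.1 p.2)
      = Measure.pi fun p => bernoulliMeasure true false (rate p.1 p.2) := by
  refine Measure.ext_of_singleton fun b => ?_
  have hpreimage : (fun a (p : Fin n × Fin n) => a p.1 p.2) ⁻¹' {b}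
      = {(Function.curry b : Arrivals n)} := by
    ext a
    simp [funext_iff]
  have hbernoulli (p : unitInterval) (c : Bool) : bernoulliMeasure true false p {c}
      = ENNReal.ofReal (if c then (p : ℝ) else 1 - p) := by
    cases c
    · rw [bernoulliMeasure_apply_of_notMem_of_mem _ .of_discrete (by simp) (by simp)]
      exact (ENNReal.ofReal_eq_coe_nnreal (unitInterval.symm p).2.1).symm
    · rw [bernoulliMeasure_apply_of_mem_of_notMem _ .of_discrete (by simp) (by simp)]
      exact (ENNReal.ofReal_eq_coe_nnreal p.2.1).symm
  rw [Measure.map_apply .of_discrete .of_discrete, hpreimage,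
    PMF.toMeasure_apply_singleton _ _ .of_discrete, Measure.pi_singleton, Fintype.prod_prod_type]
  simp only [hbernoulli]
  rfl

theorem map_eval_arrivalLaw (p : Fin n × Fin n) :
    (arrivalLaw rate).toMeasure.map (fun a => a p.1 p.2)
      = bernoulliMeasure true false (rate p.1 p.2) := by
  rw [← (measurePreserving_eval (fun p : Fin n × Fin n =>
    bernoulliMeasure true false (rate p.1 p.2)) p).map_eq, ← map_arrivalLaw,
    Measure.map_map (measurable_pi_apply p) .of_discrete]
  rfl

theorem iIndepFun_arrivalLaw :
    iIndepFun (fun (p : Fin n × Fin n) (a : Arrivals n) => a p.1 p.2)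
      (arrivalLaw rate).toMeasure := by
  refine (iIndepFun_iff_map_fun_eq_pi_map fun p => Measurable.of_discrete.aemeasurable).2 ?_
  simp only [map_eval_arrivalLaw, map_arrivalLaw]

theorem integral_arrival (f : Bool → ℝ) (p : Fin n × Fin n) :
    ∫ a, f (a p.1 p.2) ∂(arrivalLaw rate).toMeasure
      = rate p.1 p.2 * f true + (1 - rate p.1 p.2) * f false := by
  rw [← integral_map (φ := fun a : Arrivals n => a p.1 p.2) (f := f)
    Measurable.of_discrete.aemeasurable Measurable.of_discrete.aestronglyMeasurable,
    map_eval_arrivalLaw, integral_bernoulliMeasure, smul_eq_mul, smul_eq_mul]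

theorem integral_arrivalMatrix_apply (p : Fin n × Fin n) :
    ∫ a, arrivalMatrix a p ∂(arrivalLaw rate).toMeasure = rate p.1 p.2 := by
  simpa [arrivalMatrix] using integral_arrival rate (fun b => if b then 1 else 0) p

theorem variance_arrivalMatrix_apply (p : Fin n × Fin n) :
    Var[fun a => arrivalMatrix a p; (arrivalLaw rate).toMeasure]
      = rate p.1 p.2 * (1 - rate p.1 p.2) := by
  have hsq (a : Arrivals n) : arrivalMatrix a p ^ 2 = arrivalMatrix a p := by
    simp [arrivalMatrix]
  rw [variance_eq_sub .of_discrete]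
  simp only [Pi.pow_apply, hsq, integral_arrivalMatrix_apply]
  ring

theorem integral_sum_arrivalMatrix (S : Finset (Fin n × Fin n)) :
    ∫ a, ∑ p ∈ S, arrivalMatrix a p ∂(arrivalLaw rate).toMeasure
      = ∑ p ∈ S, (rate p.1 p.2 : ℝ) := by
  rw [integral_finsetSum _ fun _ _ => .of_finite]
  simp only [integral_arrivalMatrix_apply]

theorem variance_sum_arrivalMatrix (S : Finset (Fin n × Fin n)) :
    Var[fun a => ∑ p ∈ S, arrivalMatrix a p; (arrivalLaw rate).toMeasure]
      = ∑ p ∈ S, (rate p.1 p.2 * (1 - rate p.1 p.2) : ℝ) := by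
  have hindep : iIndepFun (fun p a => arrivalMatrix a p) (arrivalLaw rate).toMeasure :=
    (iIndepFun_arrivalLaw rate).comp (fun _ b => if b then (1 : ℝ) else 0)
      fun _ => Measurable.of_discrete
  have hsum := IndepFun.variance_sum (μ := (arrivalLaw rate).toMeasure) (s := S)
    (X := fun p a => arrivalMatrix a p) (fun _ _ => .of_discrete)
    fun _ _ _ _ hne => hindep.indepFun hne
  simp only [variance_arrivalMatrix_apply] at hsum
  rw [← hsum]
  congr 1
  ext a
  rw [Finset.sum_apply]

theorem integral_sum_arrivalMatrix_sub_sq (S : Finset (Fin n × Fin n)) (c : ℝ) :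
    ∫ a, (∑ p ∈ S, arrivalMatrix a p - c) ^ 2 ∂(arrivalLaw rate).toMeasure
      = ∑ p ∈ S, (rate p.1 p.2 * (1 - rate p.1 p.2) : ℝ)
        + (∑ p ∈ S, (rate p.1 p.2 : ℝ) - c) ^ 2 := by
  have hvariance := variance_sub_const (X := fun a => ∑ p ∈ S, arrivalMatrix a p)
    (μ := (arrivalLaw rate).toMeasure) Measurable.of_discrete.aestronglyMeasurable c
  rw [variance_sum_arrivalMatrix, variance_eq_sub .of_discrete,
    integral_sub .of_finite .of_finite, integral_sum_arrivalMatrix] at hvariance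
  simp only [Pi.pow_apply, integral_const, probReal_univ, one_smul] at hvariance
  linarith

end ArrivalMoments

section OneStep

variable {n : ℕ} {rate : Fin n → Fin n → unitInterval}
  {policy : QueueState n → PMF (Schedule n)}

theorem mem_support_step {q q' : QueueState n} :
    q' ∈ (step rate policy q).support
      ↔ ∃ s ∈ (policy q).support, ∃ a ∈ (arrivalLaw rate).support, nextQueue q a s = q' := by
  simp only [step, PMF.mem_support_bind_iff, PMF.mem_support_map_iff]

theorem integrable_step (F : QueueState n → ℝ) (q : QueueState n) :
    Integrable F (step rate policy q).toMeasure := by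
  obtain ⟨B, hB⟩ := (Set.finite_range fun z : Schedule n × Arrivals n =>
    |F (nextQueue q z.2 z.1)|).bddAbove
  refine integrable_of_bounded_on_support (B := B) fun q' hq' => ?_
  obtain ⟨s, -, a, -, rfl⟩ := mem_support_step.1 hq'
  exact hB ⟨(s, a), rfl⟩

theorem integral_step_le {F : QueueState n → ℝ} {q : QueueState n} {b : ℝ}
    (hF : ∀ s ∈ (policy q).support,
      ∫ a, F (nextQueue q a s) ∂(arrivalLaw rate).toMeasure ≤ b) :
    ∫ q', F q' ∂(step rate policy q).toMeasure ≤ b := by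
  let _ : MeasurableSpace (Schedule n) := ⊤
  have hF' : Integrable F (step rate policy q).toMeasure := integrable_step F q
  have hinner (s : Schedule n) :
      ∫ q', F q' ∂((arrivalLaw rate).map fun a => nextQueue q a s).toMeasure
        = ∫ a, F (nextQueue q a s) ∂(arrivalLaw rate).toMeasure := by
    rw [← PMF.toMeasure_map _ _ Measurable.of_discrete,
      integral_map Measurable.of_discrete.aemeasurable Measurable.of_discrete.aestronglyMeasurable]
  calc ∫ q', F q' ∂(step rate policy q).toMeasure
      = ∫ s, ∫ a, F (nextQueue q a s) ∂(arrivalLaw rate).toMeasure ∂(policy q).toMeasure := by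
        simp only [step, integral_pmf_bind hF', hinner]
    _ ≤ ∫ _s, b ∂(policy q).toMeasure :=
        integral_mono_ae .of_finite (integrable_const b) (ae_toMeasure_iff.2 hF)
    _ = b := by simp

theorem abs_integral_step_sub_le {F G : QueueState n → ℝ} {q : QueueState n} {c : ℝ}
    (h : ∀ s ∈ (policy q).support,
      |∫ a, F (nextQueue q a s) ∂(arrivalLaw rate).toMeasure - c|
        ≤ ∫ a, G (nextQueue q a s) ∂(arrivalLaw rate).toMeasure) :
    |∫ q', F q' ∂(step rate policy q).toMeasure - c|
      ≤ ∫ q', G q' ∂(step rate policy q).toMeasure := by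
  have hupper : ∫ q', (F q' - G q') ∂(step rate policy q).toMeasure ≤ c :=
    integral_step_le fun s hs => by
      rw [integral_sub .of_finite .of_finite]
      linarith [(abs_le.1 (h s hs)).2]
  have hlower : ∫ q', (-F q' - G q') ∂(step rate policy q).toMeasure ≤ -c :=
    integral_step_le fun s hs => by
      rw [integral_sub .of_finite .of_finite, integral_neg]
      linarith [(abs_le.1 (h s hs)).1]
  rw [integral_sub (integrable_step _ q) (integrable_step _ q)] at hupper hlower
  rw [integral_neg] at hlower
  exact abs_le.2 ⟨by linarith, by linarith⟩

variable (q : QueueState n) (a : Arrivals n) (s : Schedule n)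

/-- The matrix of the queue lengths. -/
def queueMatrix : MatrixSpace (Fin n) := WithLp.toLp 2 fun p => (q p.1 p.2 : ℝ)

/-- The matrix of the unused services: the schedule `s` serves the pair `(i, j)`, but no packet is
there to be transmitted. -/
def idleMatrix : MatrixSpace (Fin n) :=
  WithLp.toLp 2 fun p => if s p.1 = p.2 ∧ q p.1 p.2 = 0 ∧ a p.1 p.2 = false then 1 else 0

theorem queueMatrix_nonneg (i j : Fin n) : 0 ≤ queueMatrix q (i, j) := Nat.cast_nonneg _

theorem total_queueMatrix : total (queueMatrix q) = totalQueue q := rfl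

theorem queueMatrix_nextQueue : queueMatrix (nextQueue q a s)
    = queueMatrix q + (arrivalMatrix a - permMatrix s) + idleMatrix q a s := by
  ext ⟨i, j⟩
  simp only [queueMatrix, nextQueue, arrivalMatrix, permMatrix, idleMatrix, PiLp.add_apply,
    PiLp.sub_apply]
  rcases q i j with - | k <;> by_cases hs : s i = j <;> cases a i j <;> simp [hs]

theorem inner_queueMatrix_nextQueue_idleMatrix :
    ⟪queueMatrix (nextQueue q a s), idleMatrix q a s⟫_ℝ = 0 := by
  rw [inner_eq_sum_sum]
  refine Finset.sum_eq_zero fun i _ => Finset.sum_eq_zero fun j _ => ?_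
  simp only [queueMatrix, nextQueue, idleMatrix]
  split_ifs with h <;> simp_all

theorem abs_queueMatrix_nextQueue_sub_le (p : Fin n × Fin n) :
    |(queueMatrix (nextQueue q a s) - queueMatrix q) p| ≤ 1 := by
  simp only [queueMatrix, nextQueue, PiLp.sub_apply]
  rcases q p.1 p.2 with - | k <;> by_cases hs : s p.1 = p.2 <;> cases a p.1 p.2 <;> simp [hs]

theorem norm_queueMatrix_nextQueue_sub_le :
    ‖queueMatrix (nextQueue q a s) - queueMatrix q‖ ≤ n := by
  refine le_of_sq_le_sq ?_ (Nat.cast_nonneg n)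
  calc ‖queueMatrix (nextQueue q a s) - queueMatrix q‖ ^ 2
      ≤ ∑ _p : Fin n × Fin n, (1 : ℝ) := by
        rw [EuclideanSpace.real_norm_sq_eq]
        exact Finset.sum_le_sum fun p _ =>
          (sq_le_one_iff_abs_le_one _).2 (abs_queueMatrix_nextQueue_sub_le q a s p)
    _ = (n : ℝ) ^ 2 := by simp [sq]

variable {q s}

theorem integral_queueMatrix_nextQueue_sub_apply (p : Fin n × Fin n) :
    ∫ a, (queueMatrix (nextQueue q a s) - queueMatrix q) p ∂(arrivalLaw rate).toMeasure
      = rate p.1 p.2 - if s p.1 = p.2 then (if q p.1 p.2 = 0 then (rate p.1 p.2 : ℝ) else 1)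
        else 0 := by
  refine (integral_arrival rate (fun b => ((q p.1 p.2 + (if b then 1 else 0)
    - (if s p.1 = p.2 then 1 else 0) : ℕ) : ℝ) - q p.1 p.2) p).trans ?_
  rcases q p.1 p.2 with - | k <;> by_cases hs : s p.1 = p.2 <;> simp [hs]

theorem integral_inner_queueMatrix_nextQueue_sub {r : unitInterval} (x : MatrixSpace (Fin n)) :
    ∫ a, ⟪x, queueMatrix (nextQueue q a s) - queueMatrix q⟫_ℝ
        ∂(arrivalLaw fun _ _ => r).toMeasure
      = r * total x - r * ∑ i, x (i, s i)
        - (1 - r) * ∑ i with queueMatrix q (i, s i) ≠ 0, x (i, s i) := by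
  simp only [inner_eq_sum_sum]
  rw [integral_finsetSum _ fun _ _ => .of_finite]
  simp only [integral_finsetSum _ fun _ _ => Integrable.of_finite, integral_const_mul,
    integral_queueMatrix_nextQueue_sub_apply, mul_sub, mul_ite, mul_zero, mul_one,
    Finset.sum_sub_distrib, Finset.sum_ite_eq, Finset.mem_univ, if_true, total, Finset.sum_filter,
    Finset.mul_sum]
  rw [sub_sub, ← Finset.sum_add_distrib]
  congr 1
  · simp only [mul_comm]
  · refine Finset.sum_congr rfl fun i _ => ?_
    by_cases hq : q i (s i) = 0 <;> simp [queueMatrix, hq] <;> ring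

end OneStep

section SwitchDrift

variable {n : ℕ} {policy : QueueState n → PMF (Schedule n)}

theorem sqDrift_norm_starProjection {rate : Fin n → Fin n → unitInterval} {δ : ℝ}
    (U : Submodule ℝ (MatrixSpace (Fin n)))
    (hdrift : ∀ q, ∀ s ∈ (policy q).support,
      2 * ∫ a, ⟪U.starProjection (queueMatrix q), queueMatrix (nextQueue q a s) - queueMatrix q⟫_ℝ
        ∂(arrivalLaw rate).toMeasure ≤ -δ * ‖U.starProjection (queueMatrix q)‖) :
    SqDrift (step rate policy) (fun q => ‖U.starProjection (queueMatrix q)‖) δ (n ^ 2) n where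
  nonneg q := norm_nonneg _
  abs_sub_le q q' hq' := by
    obtain ⟨s, -, a, -, rfl⟩ := mem_support_step.1 hq'
    calc _ ≤ ‖U.starProjection (queueMatrix (nextQueue q a s))
            - U.starProjection (queueMatrix q)‖ := abs_norm_sub_norm_le _ _
      _ ≤ ‖queueMatrix (nextQueue q a s) - queueMatrix q‖ := by
          rw [← map_sub]
          exact U.norm_starProjection_apply_le _
      _ ≤ n := norm_queueMatrix_nextQueue_sub_le q a s
  drift q := by
    refine integral_step_le fun s hs => ?_
    have hpoint (a : Arrivals n) : ‖U.starProjection (queueMatrix (nextQueue q a s))‖ ^ 2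
        ≤ ‖U.starProjection (queueMatrix q)‖ ^ 2 + n ^ 2
          + 2 * ⟪U.starProjection (queueMatrix q),
            queueMatrix (nextQueue q a s) - queueMatrix q⟫_ℝ := by
      set x := queueMatrix q
      set z := queueMatrix (nextQueue q a s) - x with hz
      have hinner : ⟪U.starProjection x, U.starProjection z⟫_ℝ = ⟪U.starProjection x, z⟫_ℝ := by
        rw [← U.inner_starProjection_left_eq_right, U.starProjection_eq_self_iff.2
          (U.starProjection_apply_mem x)]
      have hnorm : ‖U.starProjection z‖ ≤ n :=
        (U.norm_starProjection_apply_le z).trans (norm_queueMatrix_nextQueue_sub_le q a s)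
      have hsq : ‖U.starProjection z‖ ^ 2 ≤ (n : ℝ) ^ 2 := by gcongr
      rw [← sub_add_cancel (queueMatrix (nextQueue q a s)) x, ← hz, add_comm z, map_add,
        norm_add_sq_real, hinner]
      linarith
    calc _ ≤ _ := integral_mono .of_finite .of_finite hpoint
      _ = ‖U.starProjection (queueMatrix q)‖ ^ 2 + n ^ 2 + 2 * ∫ a,
          ⟪U.starProjection (queueMatrix q), queueMatrix (nextQueue q a s) - queueMatrix q⟫_ℝ
            ∂(arrivalLaw rate).toMeasure := by
        rw [integral_add .of_finite .of_finite, integral_const_mul, integral_const, probReal_univ,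
          one_smul]
      _ ≤ _ := by linarith [hdrift q s hs]

theorem IsMaxWeight.sum_queueMatrix_le (hpolicy : IsMaxWeight policy) {q : QueueState n}
    {s : Schedule n} (hs : s ∈ (policy q).support) (σ : Schedule n) :
    ∑ i, queueMatrix q (i, σ i) ≤ ∑ i, queueMatrix q (i, s i) := by
  simpa only [weight, queueMatrix, ← Nat.cast_sum, Nat.cast_le] using hpolicy q s hs σ

variable [NeZero n] {r : unitInterval}

theorem IsMaxWeight.sqDrift_norm_queueMatrix (hpolicy : IsMaxWeight policy)
    (hr : (r : ℝ) * n < 1) :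
    SqDrift (step (fun _ _ => r) policy) (fun q => ‖queueMatrix q‖)
      (2 * (1 - r * n) / n) (n ^ 2) n := by
  suffices h : SqDrift (step (fun _ _ => r) policy)
      (fun q => ‖(⊤ : Submodule ℝ (MatrixSpace (Fin n))).starProjection (queueMatrix q)‖)
      (2 * (1 - r * n) / n) (n ^ 2) n by
    simpa only [Submodule.starProjection_top, ContinuousLinearMap.id_apply] using h
  refine sqDrift_norm_starProjection ⊤ fun q s hs => ?_
  have hn : (0 : ℝ) < n := Nat.cast_pos.2 (NeZero.pos n)
  have hserved : ∑ i with queueMatrix q (i, s i) ≠ 0, queueMatrix q (i, s i)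
      = ∑ i, queueMatrix q (i, s i) := Finset.sum_filter_ne_zero _
  have htotal : total (queueMatrix q) ≤ n * ∑ i, queueMatrix q (i, s i) := by
    simpa only [Fintype.card_fin, total] using
      sum_le_card_mul (x := fun i j => queueMatrix q (i, j)) (hpolicy.sum_queueMatrix_le hs)
  have hnorm : ‖queueMatrix q‖ ≤ n * ∑ i, queueMatrix q (i, s i) :=
    (norm_le_total (queueMatrix_nonneg q)).trans htotal
  rw [Submodule.starProjection_top, ContinuousLinearMap.id_apply,
    integral_inner_queueMatrix_nextQueue_sub, hserved]
  set M := ∑ i, queueMatrix q (i, s i)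
  have harrival : r * total (queueMatrix q) ≤ r * (n * M) :=
    mul_le_mul_of_nonneg_left htotal r.2.1
  have hdrift : 2 * (1 - (r : ℝ) * n) / n * ‖queueMatrix q‖ ≤ 2 * (1 - r * n) / n * (n * M) :=
    mul_le_mul_of_nonneg_left hnorm (div_nonneg (by linarith) hn.le)
  have hcancel : 2 * (1 - (r : ℝ) * n) / n * (n * M) = 2 * (1 - r * n) * M := by field_simp
  linarith

theorem IsMaxWeight.sqDrift_norm_starProjection_zeroMargins (hpolicy : IsMaxWeight policy) {δ : ℝ}
    (hδ : δ ≤ 2 * r / n ^ 2) :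
    SqDrift (step (fun _ _ => r) policy)
      (fun q => ‖(zeroMargins (Fin n)).starProjection (queueMatrix q)‖) δ (n ^ 2) n := by
  refine sqDrift_norm_starProjection _ fun q s hs => ?_
  have hn : (0 : ℝ) < n := Nat.cast_pos.2 (NeZero.pos n)
  have hcollapse := norm_starProjection_zeroMargins_le (hpolicy.sum_queueMatrix_le hs)
  have hserved := sum_starProjection_zeroMargins_nonneg (queueMatrix_nonneg q)
    (hpolicy.sum_queueMatrix_le hs)
  rw [integral_inner_queueMatrix_nextQueue_sub, total_starProjection_zeroMargins,
    sum_starProjection_zeroMargins]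
  rw [Fintype.card_fin] at hcollapse ⊢
  have hunserved := mul_nonneg (sub_nonneg.2 r.2.2) hserved
  set M := ∑ i, queueMatrix q (i, s i)
  set T := total (queueMatrix q)
  have hdrift : δ * ‖(zeroMargins (Fin n)).starProjection (queueMatrix q)‖
      ≤ 2 * (r : ℝ) / n ^ 2 * (n * (n * M - T)) :=
    mul_le_mul hδ hcollapse (norm_nonneg _) (div_nonneg (by linarith [r.2.1]) (by positivity))
  have hcancel : 2 * (r : ℝ) / n ^ 2 * (n * (n * M - T)) = 2 * (r * (M - T / n)) := by field_simp
  linarith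

end SwitchDrift

section SwitchSteadyState

variable {n : ℕ} {policy : QueueState n → PMF (Schedule n)}

theorem finite_norm_queueMatrix_le (B : ℝ) : {q : QueueState n | ‖queueMatrix q‖ ≤ B}.Finite := by
  refine (Set.finite_Icc (0 : QueueState n) fun _ _ => ⌊B⌋₊).subset fun q hq =>
    ⟨fun i j => Nat.zero_le _, fun i j => Nat.le_floor ?_⟩
  calc (q i j : ℝ) = ‖queueMatrix q (i, j)‖ := (Real.norm_natCast _).symm
    _ ≤ ‖queueMatrix q‖ := PiLp.norm_apply_le _ _
    _ ≤ B := hq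

theorem false_mem_support_arrivalLaw {rate : Fin n → Fin n → unitInterval}
    (hrate : ∀ i j, (rate i j : ℝ) < 1) :
    (fun _ _ => false : Arrivals n) ∈ (arrivalLaw rate).support := by
  rw [arrivalLaw, PMF.mem_support_ofFintype_iff]
  simp [Finset.prod_eq_zero_iff, hrate]

theorem IsMaxWeight.exists_apply_ne_zero (hpolicy : IsMaxWeight policy) {q : QueueState n}
    {s : Schedule n} (hs : s ∈ (policy q).support) (hq : q ≠ 0) : ∃ k, q k (s k) ≠ 0 := by
  by_contra! hzero
  refine hq (funext fun i => funext fun j => Nat.eq_zero_of_le_zero ?_)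
  calc q i j = q i (Equiv.swap i j i) := by rw [Equiv.swap_apply_left]
    _ ≤ weight q (Equiv.swap i j) :=
        Finset.single_le_sum (f := fun k => q k (Equiv.swap i j k)) (fun _ _ => Nat.zero_le _)
          (Finset.mem_univ i)
    _ ≤ weight q s := hpolicy q s hs _
    _ = 0 := Finset.sum_eq_zero fun k _ => hzero k

theorem IsMaxWeight.exists_sum_le_sub_one (hpolicy : IsMaxWeight policy)
    {rate : Fin n → Fin n → unitInterval} (hrate : ∀ i j, (rate i j : ℝ) < 1) (q : QueueState n) :
    ∃ q' ∈ (step rate policy q).support, ∑ i, ∑ j, q' i j ≤ ∑ i, ∑ j, q i j - 1 := by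
  obtain ⟨s, hs⟩ := (policy q).support_nonempty
  refine ⟨_, mem_support_step.2 ⟨s, hs, _, false_mem_support_arrivalLaw hrate, rfl⟩, ?_⟩
  have hle (i j : Fin n) : nextQueue q (fun _ _ => false) s i j ≤ q i j := by simp [nextQueue]
  have hsum_le (i : Fin n) : ∑ j, nextQueue q (fun _ _ => false) s i j ≤ ∑ j, q i j :=
    Finset.sum_le_sum fun j _ => hle i j
  rcases eq_or_ne q 0 with rfl | hq
  · simpa using Finset.sum_le_sum fun i (_ : i ∈ Finset.univ) => hsum_le i
  · obtain ⟨k, hk⟩ := hpolicy.exists_apply_ne_zero hs hq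
    have hlt : nextQueue q (fun _ _ => false) s k (s k) < q k (s k) := by
      simpa [nextQueue] using Nat.pos_of_ne_zero hk
    exact Nat.le_sub_one_of_lt (Finset.sum_lt_sum (fun i _ => hsum_le i) ⟨k, Finset.mem_univ k,
      Finset.sum_lt_sum (fun j _ => hle k j) ⟨s k, Finset.mem_univ _, hlt⟩⟩)

variable [NeZero n] {r : unitInterval}

theorem IsMaxWeight.exists_isSteadyState (hpolicy : IsMaxWeight policy) (hr : (r : ℝ) * n < 1) :
    ∃ p, IsSteadyState (step (fun _ _ => r) policy) p := by
  have hn : (1 : ℝ) ≤ n := Nat.one_le_cast.2 (NeZero.pos n)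
  have hr1 : (r : ℝ) < 1 := (le_mul_of_one_le_right r.2.1 hn).trans_lt hr
  have hfinite (M : ℝ≥0∞) (hM : M ≠ ⊤) :
      {q : QueueState n | ENNReal.ofReal (‖queueMatrix q‖ ^ 2) ≤ M}.Finite :=
    (finite_norm_queueMatrix_le √M.toReal).subset fun q hq =>
      Real.le_sqrt_of_sq_le ((ENNReal.ofReal_le_iff_le_toReal hM).1 hq)
  refine Switch.exists_isSteadyState (fun _ => ENNReal.ofReal_ne_top) ENNReal.ofReal_ne_top hfinite
    ((hpolicy.sqDrift_norm_queueMatrix hr).lintegral_pow_four_le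
      (div_pos (by linarith) (by linarith)) (by positivity))
    (hpolicy.exists_sum_le_sub_one fun _ _ => hr1) fun x y hx hy => ?_
  simp only [Finset.sum_eq_zero_iff, Finset.mem_univ, true_imp_iff] at hx hy
  exact funext₂ fun i j => (hx i j).trans (hy i j).symm

theorem IsMaxWeight.integrable_totalQueue (hpolicy : IsMaxWeight policy) (hr : (r : ℝ) * n < 1)
    {p : PMF (QueueState n)} (hp : p.bind (step (fun _ _ => r) policy) = p) :
    Integrable totalQueue p.toMeasure := by
  have hn : (0 : ℝ) < n := Nat.cast_pos.2 (NeZero.pos n)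
  have hnorm : Integrable (fun q => ‖queueMatrix q‖) p.toMeasure :=
    ((hpolicy.sqDrift_norm_queueMatrix hr).memLp_two (div_pos (by linarith) hn) (by positivity)
      hp).integrable one_le_two
  refine (hnorm.mul_const ‖ones (Fin n)‖).mono' Measurable.of_discrete.aestronglyMeasurable
    (.of_forall fun q => ?_)
  rw [← total_queueMatrix, ← inner_ones]
  exact norm_inner_le_norm _ _

end SwitchSteadyState

section OrthogonalProjection

variable {E : Type*} [NormedAddCommGroup E] [InnerProductSpace ℝ E] (U : Submodule ℝ E)
  [U.HasOrthogonalProjection]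

theorem norm_sq_starProjection_orthogonal_add {x d u : E} (hu : ⟪x + d + u, u⟫_ℝ = 0) :
    ‖Uᗮ.starProjection (x + d + u)‖ ^ 2 = ‖Uᗮ.starProjection x‖ ^ 2
      + 2 * ⟪Uᗮ.starProjection x, d⟫_ℝ + ‖Uᗮ.starProjection d‖ ^ 2
      - 2 * ⟪U.starProjection (x + d + u), u⟫_ℝ - ‖Uᗮ.starProjection u‖ ^ 2 := by
  have hinner (y z : E) :
      ⟪Uᗮ.starProjection y, Uᗮ.starProjection z⟫_ℝ = ⟪Uᗮ.starProjection y, z⟫_ℝ := by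
    rw [← Uᗮ.inner_starProjection_left_eq_right, Uᗮ.starProjection_eq_self_iff.2
      (Uᗮ.starProjection_apply_mem y)]
  have hcomplement :
      ⟪Uᗮ.starProjection (x + d + u), u⟫_ℝ = -⟪U.starProjection (x + d + u), u⟫_ℝ := by
    rw [Submodule.starProjection_orthogonal_val, inner_sub_left, hu, zero_sub]
  have hforward := norm_add_sq_real (Uᗮ.starProjection x) (Uᗮ.starProjection d)
  have hbackward := norm_sub_sq_real (Uᗮ.starProjection (x + d + u)) (Uᗮ.starProjection u)
  rw [← map_add, hinner] at hforward
  rw [← map_sub, add_sub_cancel_right, hinner, hcomplement] at hbackward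
  linarith

theorem abs_norm_sq_starProjection_orthogonal_add_sub_le {x d u : E} {η : ℝ} (hη : 0 < η)
    (hu : ⟪x + d + u, u⟫_ℝ = 0) :
    |‖Uᗮ.starProjection (x + d + u)‖ ^ 2 - (‖Uᗮ.starProjection x‖ ^ 2
      + 2 * ⟪Uᗮ.starProjection x, d⟫_ℝ + ‖Uᗮ.starProjection d‖ ^ 2)|
      ≤ η * ‖U.starProjection (x + d + u)‖ ^ 2 + (1 / η + 1) * ‖u‖ ^ 2 := by
  set y := U.starProjection (x + d + u)
  have hCauchySchwarz : |⟪y, u⟫_ℝ| ≤ ‖y‖ * ‖u‖ := abs_real_inner_le_norm _ _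
  have hAMGM : 2 * (‖y‖ * ‖u‖) ≤ η * ‖y‖ ^ 2 + 1 / η * ‖u‖ ^ 2 := by
    have hsq : 0 ≤ (η * ‖y‖ - ‖u‖) ^ 2 / η := by positivity
    have hexpand : (η * ‖y‖ - ‖u‖) ^ 2 / η
        = η * ‖y‖ ^ 2 + 1 / η * ‖u‖ ^ 2 - 2 * (‖y‖ * ‖u‖) := by
      field_simp
      ring
    linarith
  have hnorm : ‖Uᗮ.starProjection u‖ ^ 2 ≤ ‖u‖ ^ 2 := by
    gcongr
    exact Uᗮ.norm_starProjection_apply_le u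
  have hbounds := abs_le.1 hCauchySchwarz
  rw [norm_sq_starProjection_orthogonal_add U hu, abs_le]
  constructor <;> linarith [sq_nonneg ‖Uᗮ.starProjection u‖]

end OrthogonalProjection

section MarginDrift

variable {n : ℕ}

theorem norm_sq_idleMatrix (q : QueueState n) (a : Arrivals n) (s : Schedule n) :
    ‖idleMatrix q a s‖ ^ 2 = totalQueue (nextQueue q a s) - totalQueue q
      - total (arrivalMatrix a) + n := by
  have hsq : ‖idleMatrix q a s‖ ^ 2 = total (idleMatrix q a s) := by
    rw [EuclideanSpace.real_norm_sq_eq, total, ← Fintype.sum_prod_type]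
    exact Finset.sum_congr rfl fun p _ => by simp [idleMatrix]
  rw [hsq, ← total_queueMatrix, ← total_queueMatrix, queueMatrix_nextQueue]
  simp only [total_add, total_sub, total_permMatrix, Fintype.card_fin]
  ring

variable (r : unitInterval)

theorem integral_inner_arrivalMatrix (x : MatrixSpace (Fin n)) :
    ∫ a, ⟪x, arrivalMatrix a⟫_ℝ ∂(arrivalLaw fun _ _ => r).toMeasure = r * total x := by
  simp only [inner_eq_sum_sum]
  rw [integral_finsetSum _ fun _ _ => .of_finite]
  simp only [integral_finsetSum _ fun _ _ => Integrable.of_finite, integral_const_mul,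
    integral_arrivalMatrix_apply, ← Finset.sum_mul]
  exact mul_comm _ _

theorem integral_total_arrivalMatrix :
    ∫ a, total (arrivalMatrix a) ∂(arrivalLaw fun _ _ : Fin n => r).toMeasure = r * n ^ 2 := by
  simp only [← inner_ones, real_inner_comm (ones (Fin n))]
  rw [integral_inner_arrivalMatrix]
  simp [total, ones, sq]

variable [NeZero n]

theorem integral_inner_margins (q : QueueState n) (s : Schedule n) :
    ∫ a, ⟪(zeroMargins (Fin n))ᗮ.starProjection (queueMatrix q),
        arrivalMatrix a - permMatrix s⟫_ℝ ∂(arrivalLaw fun _ _ => r).toMeasure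
      = -((1 - r * n) / n * totalQueue q) := by
  simp only [Submodule.starProjection_orthogonal_val, inner_sub_left, inner_sub_right,
    inner_permMatrix, sum_starProjection_zeroMargins]
  rw [integral_sub .of_finite .of_finite, integral_sub .of_finite .of_finite,
    integral_sub .of_finite .of_finite, integral_inner_arrivalMatrix, integral_inner_arrivalMatrix,
    total_starProjection_zeroMargins]
  simp only [integral_const, probReal_univ, one_smul, total_queueMatrix, Fintype.card_fin]
  have hn : (n : ℝ) ≠ 0 := NeZero.ne _
  field_simp
  ring

theorem integral_norm_sq_margins (s : Schedule n) :
    ∫ a, ‖(zeroMargins (Fin n))ᗮ.starProjection (arrivalMatrix a - permMatrix s)‖ ^ 2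
        ∂(arrivalLaw fun _ _ => r).toMeasure
      = (2 * n - 1) * (r * (1 - r)) + (1 - r * n) ^ 2 := by
  have hrow (a : Arrivals n) (i : Fin n) : rowSum (arrivalMatrix a - permMatrix s) i
      = ∑ p ∈ {i} ×ˢ Finset.univ, arrivalMatrix a p - 1 := by
    rw [← rowSum_permMatrix s i, Finset.sum_product, Finset.sum_singleton]
    exact Finset.sum_sub_distrib _ _
  have hcol (a : Arrivals n) (j : Fin n) : colSum (arrivalMatrix a - permMatrix s) j
      = ∑ p ∈ Finset.univ ×ˢ {j}, arrivalMatrix a p - 1 := by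
    rw [← colSum_permMatrix s j, Finset.sum_product_right, Finset.sum_singleton]
    exact Finset.sum_sub_distrib _ _
  have htotal (a : Arrivals n) : total (arrivalMatrix a - permMatrix s)
      = ∑ p, arrivalMatrix a p - n := by
    rw [total_sub, total_permMatrix, Fintype.card_fin, Fintype.sum_prod_type, total]
  simp only [norm_sq_starProjection_orthogonal_zeroMargins, hrow, hcol, htotal]
  rw [integral_sub .of_finite .of_finite, integral_div, integral_div,
    integral_add .of_finite .of_finite, integral_finsetSum _ fun _ _ => .of_finite,
    integral_finsetSum _ fun _ _ => .of_finite]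
  simp only [integral_sum_arrivalMatrix_sub_sq, Finset.sum_const, Finset.card_product,
    Finset.card_singleton, Finset.card_univ, Fintype.card_fin, Fintype.card_prod, one_mul, mul_one,
    nsmul_eq_mul, Nat.cast_mul]
  have hn : (n : ℝ) ≠ 0 := NeZero.ne _
  field_simp
  ring

theorem abs_integral_step_norm_sq_margins_sub_le (policy : QueueState n → PMF (Schedule n))
    (q : QueueState n) {η : ℝ} (hη : 0 < η) :
    |∫ q', ‖(zeroMargins (Fin n))ᗮ.starProjection (queueMatrix q')‖ ^ 2
        ∂(step (fun _ _ => r) policy q).toMeasure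
      - (‖(zeroMargins (Fin n))ᗮ.starProjection (queueMatrix q)‖ ^ 2
        - (2 * ((1 - r * n) / n * totalQueue q)
          - ((2 * n - 1) * (r * (1 - r)) + (1 - r * n) ^ 2)))|
      ≤ ∫ q', (η * ‖(zeroMargins (Fin n)).starProjection (queueMatrix q')‖ ^ 2
          + (1 / η + 1) * totalQueue q') ∂(step (fun _ _ => r) policy q).toMeasure
        - (1 / η + 1) * (totalQueue q - n * (1 - r * n)) := by
  set c := (1 / η + 1) * (totalQueue q - n * (1 - r * n)) with hc
  suffices h : _ ≤ ∫ q', (η * ‖(zeroMargins (Fin n)).starProjection (queueMatrix q')‖ ^ 2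
      + (1 / η + 1) * totalQueue q' - c) ∂(step (fun _ _ => r) policy q).toMeasure by
    rwa [integral_sub (integrable_step _ q) (integrable_const c), integral_const, probReal_univ,
      one_smul] at h
  refine abs_integral_step_sub_le fun s _ => ?_
  let F (a : Arrivals n) := ‖(zeroMargins (Fin n))ᗮ.starProjection (queueMatrix q)‖ ^ 2
    + 2 * ⟪(zeroMargins (Fin n))ᗮ.starProjection (queueMatrix q),
      arrivalMatrix a - permMatrix s⟫_ℝ
    + ‖(zeroMargins (Fin n))ᗮ.starProjection (arrivalMatrix a - permMatrix s)‖ ^ 2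
  have hF : ∫ a, F a ∂(arrivalLaw fun _ _ => r).toMeasure
      = ‖(zeroMargins (Fin n))ᗮ.starProjection (queueMatrix q)‖ ^ 2
        - (2 * ((1 - r * n) / n * totalQueue q)
          - ((2 * n - 1) * (r * (1 - r)) + (1 - r * n) ^ 2)) := by
    rw [integral_add .of_finite .of_finite, integral_add .of_finite .of_finite, integral_const_mul,
      integral_inner_margins, integral_norm_sq_margins, integral_const, probReal_univ, one_smul]
    ring
  have hpoint (a : Arrivals n) :=
    abs_norm_sq_starProjection_orthogonal_add_sub_le (zeroMargins (Fin n)) hη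
      ((queueMatrix_nextQueue q a s) ▸ inner_queueMatrix_nextQueue_idleMatrix q a s)
  simp only [← queueMatrix_nextQueue, norm_sq_idleMatrix] at hpoint
  rw [← hF, ← integral_sub .of_finite .of_finite]
  refine (abs_integral_le_integral_abs.trans
    (integral_mono .of_finite .of_finite hpoint)).trans_eq ?_
  simp only [integral_add Integrable.of_finite Integrable.of_finite, integral_const_mul,
    integral_sub Integrable.of_finite Integrable.of_finite, integral_total_arrivalMatrix,
    integral_const, probReal_univ, one_smul, hc]
  ring

end MarginDrift

section Stationary

variable {α : Type*} [MeasurableSpace α] [DiscreteMeasurableSpace α] [Countable α]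
  {K : α → PMF α} {p : PMF α}

theorem integral_integral_of_stationary {f : α → ℝ} (hp : p.bind K = p)
    (hf : Integrable f p.toMeasure) :
    ∫ x, ∫ y, f y ∂(K x).toMeasure ∂p.toMeasure = ∫ x, f x ∂p.toMeasure := by
  rw [← integral_pmf_bind (by rwa [hp]), hp]

theorem abs_integral_le_of_stationary {F G c g : α → ℝ} (hp : p.bind K = p)
    (hF : Integrable F p.toMeasure) (hG : Integrable G p.toMeasure)
    (hc : Integrable c p.toMeasure) (hg : Integrable g p.toMeasure)
    (h : ∀ x, |∫ y, F y ∂(K x).toMeasure - (F x - c x)| ≤ ∫ y, G y ∂(K x).toMeasure - g x) :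
    |∫ x, c x ∂p.toMeasure| ≤ ∫ x, G x ∂p.toMeasure - ∫ x, g x ∂p.toMeasure := by
  have hKF : Integrable (fun x => ∫ y, F y ∂(K x).toMeasure) p.toMeasure :=
    integrable_integral_pmf_bind (by rwa [hp])
  have hKG : Integrable (fun x => ∫ y, G y ∂(K x).toMeasure) p.toMeasure :=
    integrable_integral_pmf_bind (by rwa [hp])
  have hFc : Integrable (fun x => F x - c x) p.toMeasure := hF.sub hc
  calc |∫ x, c x ∂p.toMeasure|
      = |∫ x, (∫ y, F y ∂(K x).toMeasure - (F x - c x)) ∂p.toMeasure| := by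
        rw [integral_sub hKF hFc, integral_sub hF hc,
          integral_integral_of_stationary hp hF, sub_sub_cancel]
    _ ≤ ∫ x, |∫ y, F y ∂(K x).toMeasure - (F x - c x)| ∂p.toMeasure :=
        abs_integral_le_integral_abs
    _ ≤ ∫ x, (∫ y, G y ∂(K x).toMeasure - g x) ∂p.toMeasure :=
        integral_mono (hKF.sub hFc).abs (hKG.sub hg) h
    _ = ∫ x, G x ∂p.toMeasure - ∫ x, g x ∂p.toMeasure := by
        rw [integral_sub hKG hg, integral_integral_of_stationary hp hG]

end Stationary

section MeanQueue

variable {n : ℕ} [NeZero n] {policy : QueueState n → PMF (Schedule n)} {r : unitInterval}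
  {p : PMF (QueueState n)}

theorem IsMaxWeight.integrable_norm_sq_starProjection (hpolicy : IsMaxWeight policy)
    (hr : (r : ℝ) * n < 1) (hp : p.bind (step (fun _ _ => r) policy) = p)
    (U : Submodule ℝ (MatrixSpace (Fin n))) :
    Integrable (fun q => ‖U.starProjection (queueMatrix q)‖ ^ 2) p.toMeasure := by
  have hn : (0 : ℝ) < n := Nat.cast_pos.2 (NeZero.pos n)
  have hsq : Integrable (fun q => ‖queueMatrix q‖ ^ 2) p.toMeasure :=
    ((hpolicy.sqDrift_norm_queueMatrix hr).memLp_two (div_pos (by linarith) hn) (by positivity)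
      hp).integrable_sq
  refine hsq.mono' Measurable.of_discrete.aestronglyMeasurable (.of_forall fun q => ?_)
  rw [Real.norm_of_nonneg (by positivity)]
  gcongr
  exact U.norm_starProjection_apply_le _

theorem IsMaxWeight.abs_integral_totalQueue_sub_le (hpolicy : IsMaxWeight policy)
    (hr : (r : ℝ) * n < 1) (hp : p.bind (step (fun _ _ => r) policy) = p) {δ η : ℝ} (hδ : 0 < δ)
    (hδr : δ ≤ 2 * r / n ^ 2) (hη : 0 < η) :
    |2 * ((1 - (r : ℝ) * n) / n * ∫ q, totalQueue q ∂p.toMeasure)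
        - ((2 * n - 1) * (r * (1 - r)) + (1 - r * n) ^ 2)|
      ≤ η * secondMomentBound δ (n ^ 2) n + (1 / η + 1) * (n * (1 - r * n)) := by
  have hT : Integrable totalQueue p.toMeasure := hpolicy.integrable_totalQueue hr hp
  have hmean : Integrable (fun q => 2 * ((1 - (r : ℝ) * n) / n * totalQueue q)) p.toMeasure :=
    (hT.const_mul _).const_mul 2
  have hsq := hpolicy.integrable_norm_sq_starProjection hr hp
  have hidle : Integrable (fun q => totalQueue q - n * (1 - (r : ℝ) * n)) p.toMeasure :=
    hT.sub (integrable_const _)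
  have hbalance := abs_integral_le_of_stationary hp (hsq _)
    (((hsq _).const_mul η).add (hT.const_mul (1 / η + 1))) (hmean.sub (integrable_const _))
    (hidle.const_mul (1 / η + 1))
    fun q => abs_integral_step_norm_sq_margins_sub_le r policy q hη
  simp only [Pi.add_apply, Pi.sub_apply] at hbalance
  rw [integral_sub hmean (integrable_const _),
    integral_add ((hsq _).const_mul η) (hT.const_mul (1 / η + 1)), integral_const_mul,
    integral_const_mul, integral_const_mul, integral_const_mul, integral_const_mul,
    integral_sub hT (integrable_const _)] at hbalance
  simp only [integral_const, probReal_univ, one_smul] at hbalance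
  have hcollapse := (hpolicy.sqDrift_norm_starProjection_zeroMargins hδr).integral_sq_le hδ
    (by positivity) hp
  linarith [mul_le_mul_of_nonneg_left hcollapse hη.le]

end MeanQueue

section HeavyTraffic

variable {n : ℕ}

theorem uniformRate_mul_natCast (ε : Set.Ioo (0 : ℝ) 1) (i j : Fin n) :
    (uniformRate n ε i j : ℝ) * n = 1 - ε :=
  div_mul_cancel₀ _ (Nat.cast_ne_zero.2 i.pos.ne')

theorem uniformRate_mul_natCast_lt_one (ε : Set.Ioo (0 : ℝ) 1) (i j : Fin n) :
    (uniformRate n ε i j : ℝ) * n < 1 := by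
  rw [uniformRate_mul_natCast]
  exact sub_lt_self _ ε.2.1

variable [NeZero n] {policy : QueueState n → PMF (Schedule n)}

theorem IsMaxWeight.abs_mul_integral_totalQueue_sub_le (hpolicy : IsMaxWeight policy)
    {ε : Set.Ioo (0 : ℝ) 1} (hε : (ε : ℝ) ≤ 1 / 2) {p : PMF (QueueState n)}
    (hp : p.bind (step (uniformRate n ε) policy) = p) :
    |2 / n * ((ε : ℝ) * ∫ q, totalQueue q ∂p.toMeasure)
        - ((2 * n - 1) * ((1 - ε) / n * (1 - (1 - ε) / n)) + (ε : ℝ) ^ 2)|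
      ≤ √ε * secondMomentBound (1 / n ^ 3) (n ^ 2) n + n * (√ε + ε) := by
  have hn : (0 : ℝ) < n := Nat.cast_pos.2 (NeZero.pos n)
  have hgap : (1 : ℝ) / n ^ 3 ≤ 2 * ((1 - ε) / n) / n ^ 2 := by
    rw [show 2 * ((1 - (ε : ℝ)) / n) / n ^ 2 = 2 * (1 - ε) / n ^ 3 by field_simp]
    gcongr
    linarith
  -- `√ε` balances the error terms `η` and `ε / η`.
  have hbound := hpolicy.abs_integral_totalQueue_sub_le (uniformRate_mul_natCast_lt_one ε 0 0) hp
    (by positivity) hgap (Real.sqrt_pos.2 ε.2.1)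
  rw [uniformRate_mul_natCast, sub_sub_cancel] at hbound
  have hmean (T : ℝ) : 2 / (n : ℝ) * (ε * T) = 2 * (ε / n * T) := by ring
  have hsqrt : n * (√(ε : ℝ) + ε) = (1 / √(ε : ℝ) + 1) * (n * ε) := by
    linear_combination -(n : ℝ) * Real.div_sqrt (x := (ε : ℝ))
  rw [hmean, hsqrt]
  exact hbound

theorem IsMaxWeight.tendsto_mul_integral_totalQueue (hpolicy : IsMaxWeight policy)
    {p : Set.Ioo (0 : ℝ) 1 → PMF (QueueState n)}
    (hp : ∀ ε, (p ε).bind (step (uniformRate n ε) policy) = p ε) :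
    Tendsto (fun ε : Set.Ioo (0 : ℝ) 1 => (ε : ℝ) * ∫ q, totalQueue q ∂(p ε).toMeasure)
      (comap ((↑) : Set.Ioo (0 : ℝ) 1 → ℝ) (𝓝[>] (0 : ℝ)))
      (𝓝 ((2 * (n : ℝ) - 1) / 2 * (1 - 1 / (n : ℝ)))) := by
  have hn : (n : ℝ) ≠ 0 := Nat.cast_ne_zero.2 (NeZero.ne n)
  have hzero : Tendsto ((↑) : Set.Ioo (0 : ℝ) 1 → ℝ)
      (comap ((↑) : Set.Ioo (0 : ℝ) 1 → ℝ) (𝓝[>] (0 : ℝ))) (𝓝 0) :=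
    tendsto_comap.mono_right nhdsWithin_le_nhds
  let variance (e : ℝ) : ℝ := (2 * n - 1) * ((1 - e) / n * (1 - (1 - e) / n)) + e ^ 2
  let error (e : ℝ) : ℝ := √e * secondMomentBound (1 / n ^ 3) (n ^ 2) n + n * (√e + e)
  have hvariance := ((by fun_prop : Continuous variance).tendsto 0).comp hzero
  have herror := ((by fun_prop : Continuous error).tendsto 0).comp hzero
  rw [show error 0 = 0 by simp [error]] at herror
  have hdiff : Tendsto (fun ε : Set.Ioo (0 : ℝ) 1 =>
      2 / n * ((ε : ℝ) * ∫ q, totalQueue q ∂(p ε).toMeasure) - variance ε)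
      (comap ((↑) : Set.Ioo (0 : ℝ) 1 → ℝ) (𝓝[>] (0 : ℝ))) (𝓝 0) := by
    refine squeeze_zero_norm' ?_ herror
    filter_upwards [hzero.eventually_le_const one_half_pos] with ε hε
    exact hpolicy.abs_mul_integral_totalQueue_sub_le hε (hp ε)
  have hlimit := (hdiff.add hvariance).const_mul ((n : ℝ) / 2)
  have hvalue : (n : ℝ) / 2 * (0 + variance 0) = (2 * n - 1) / 2 * (1 - 1 / n) := by
    simp only [variance]
    field_simp
    ring
  rw [hvalue] at hlimit
  refine hlimit.congr fun ε => ?_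
  simp only [Function.comp_apply, sub_add_cancel]
  field_simp

end HeavyTraffic

end Switch

end

theorem mainTheorem10 (n : ℕ) (hn : 1 ≤ n)
    (policy : Switch.QueueState n → PMF (Switch.Schedule n))
    (hpolicy : Switch.IsMaxWeight policy) :
    (∀ ε : Set.Ioo (0 : ℝ) 1, ∃! p : PMF (Switch.QueueState n),
      Switch.IsSteadyState (Switch.step (Switch.uniformRate n ε) policy) p) ∧
    ∀ p : Set.Ioo (0 : ℝ) 1 → PMF (Switch.QueueState n),
      (∀ ε, Switch.IsSteadyState (Switch.step (Switch.uniformRate n ε) policy) (p ε)) →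
      (∀ ε, Integrable Switch.totalQueue (p ε).toMeasure) ∧
      Tendsto (fun ε : Set.Ioo (0 : ℝ) 1 =>
          (ε : ℝ) * ∫ q, Switch.totalQueue q ∂(p ε).toMeasure)
        (comap ((↑) : Set.Ioo (0 : ℝ) 1 → ℝ) (𝓝[>] (0 : ℝ)))
        (𝓝 ((2 * (n : ℝ) - 1) / 2 * (1 - 1 / (n : ℝ)))) := by
  have : NeZero n := ⟨by omega⟩
  refine ⟨fun ε => ?_, fun p hp => ⟨fun ε => ?_, ?_⟩⟩
  · obtain ⟨p, hp⟩ :=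
      hpolicy.exists_isSteadyState (Switch.uniformRate_mul_natCast_lt_one ε 0 0)
    exact ⟨p, hp, fun p' hp' => hp'.unique hp⟩
  · exact hpolicy.integrable_totalQueue (Switch.uniformRate_mul_natCast_lt_one ε 0 0)
      (hp ε).stationary
  · exact hpolicy.tendsto_mul_integral_totalQueue fun ε => (hp ε).stationary
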